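/- Let $d\ge 1$. For $j=1,\dots,d$ let $p_j,q_j$ be positive functions on $(0,1)$ with $p_j/q_j$ strictly increasing, and let $$k(\mathbf x,\mathbf x')=\prod_{j=1}^d p_j(x_j\wedge x_j')\,q_j(x_j\vee x_j'),\qquad \mathbf x,\mathbf x'\in(0,1)^d,$$ be the associated tensor Markov kernel. Assume that for each $j$ the functions $p_j,q_j$ are continuously differentiable on $(0,1)$ with bounded derivatives (as is the case if they are continuously differentiable on $[0,1]$), and that both solve an equation $(u_jf')'+v_jf=0$ on $(0,1)$ with $u_j$ continuously differentiable and $v_j$ continuous on $(0,1)$. Let $\{\mathsf Y(\mathbf x):\mathbf x\in(0,1)^d\}$ be a zero mean Gaussian process with covariance function $k$, and let $\sigma:(0,1)^d\to[0,\infty)$. For $l\ge1$ let $\mathcal X_l=\{i2^{-l}:1\le i\le 2^l-1\}$. The classical sparse grid of level $\tau\ge1$ is $\mathcal X^{\mathsf{SG}}_\tau=\bigcup \mathcal X_{l_1}\times\cdots\times\mathcal X_{l_d}$, the union being over integers $l_1,\dots,l_d\ge1$ with $l_1+\cdots+l_d\le\tau+d-1$. A truncated sparse grid of size $n\ge 1$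 is a set $\mathcal X^{\mathsf{SG}}_\tau\cup\mathcal A$, where $|\mathcal X^{\mathsf{SG}}_\tau|\le n<|\mathcal X^{\mathsf{SG}}_{\tau+1}|$ and $\mathcal A$ is any set of $n-|\mathcal X^{\mathsf{SG}}_\tau|$ points of $\mathcal X^{\mathsf{SG}}_{\tau+1}\setminus\mathcal X^{\mathsf{SG}}_\tau$. For every $n\ge1$ let the design points $\mathbf x_1,\dots,\mathbf x_n$ (which may depend on $n$) form a truncated sparse grid of size $n$, let $m_1,\dots,m_n\ge1$ be integers (which may depend on $n$), and let $\bar Y_i=m_i^{-1}\sum_{r=1}^{m_i}(\mathsf Y(\mathbf x_i)+\epsilon_r(\mathbf x_i))$, where the $\epsilon_r(\mathbf x_i)$, $1\le i\le n$, $1\le r\le m_i$, are independent $N(0,\sigma^2(\mathbf x_i))$ random variables that are jointly independent of $\mathsf Y$. Let $$\widehat{\mathsf Y}_n(\mathbf x)=\mathbf k(\mathbf x)^{\mathsf T}(\mathbf K+\boldsymbol\Sigma)^{-1}\bar{\mathbf Y},$$ where $\mathbf k(\mathbf x)=(k(\mathbf x,\mathbf x_i))_{i}$, $\mathbf K=(k(\mathbf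 x_i,\mathbf x_j))_{i,j}$, $\boldsymbol\Sigma=\operatorname{diag}(\sigma^2(\mathbf x_i)/m_i)$ and $\bar{\mathbf Y}=(\bar Y_i)_i$, be the stochastic kriging predictor. If $(\log n)^d\max_{1\le i\le n}m_i^{-1/2}\sigma(\mathbf x_i)\to0$ as $n\to\infty$, then the mean squared errors below are finite, their suprema are finite, and, as $n\to\infty$, $$\sup_{\mathbf x\in(0,1)^d}\mathbb E\bigl[(\widehat{\mathsf Y}_n(\mathbf x)-\mathsf Y(\mathbf x))^2\bigr]=\mathcal O\Bigl(n^{-1}(\log n)^{2(d-1)}+(\log n)^d\max_{1\le i\le n}m_i^{-1/2}\sigma(\mathbf x_i)\Bigr).$$ -/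

import Mathlib

open MeasureTheory ProbabilityTheory Filter Topology Asymptotics Set

noncomputable section

namespace SparseKriging

/-- The open unit cube `(0,1)^d`. -/
def unitCube (d : ℕ) : Set (Fin d → ℝ) := {x | ∀ j, x j ∈ Ioo (0 : ℝ) 1}

/-! ### Tensor Markov kernels -/

/-- The kernel `k(x, y) = ∏ j, p_j (x_j ∧ y_j) * q_j (x_j ∨ y_j)`. -/
def tmKernel {d : ℕ} (p q : Fin d → ℝ → ℝ) (x y : Fin d → ℝ) : ℝ :=
  ∏ j, p j (min (x j) (y j)) * q j (max (x j) (y j))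

/-- `p` and `q` are the component functions of a tensor Markov kernel on `(0,1)^d`: they are
positive on `(0,1)`, with strictly increasing quotients. -/
structure IsTensorMarkov {d : ℕ} (p q : Fin d → ℝ → ℝ) : Prop where
  p_pos : ∀ j, ∀ t ∈ Ioo (0 : ℝ) 1, 0 < p j t
  q_pos : ∀ j, ∀ t ∈ Ioo (0 : ℝ) 1, 0 < q j t
  strictMono : ∀ j, StrictMonoOn (fun t => p j t / q j t) (Ioo (0 : ℝ) 1)

/-- `f` solves the Sturm-Liouville equation `(u f')' + v f = 0` on `(0,1)`. -/
def SolvesSturmLiouville (u v f : ℝ → ℝ) : Prop :=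
  ∀ t ∈ Ioo (0 : ℝ) 1, HasDerivAt (fun s => u s * deriv f s) (-(v t * f t)) t

/-- The Sturm-Liouville regularity of the component functions of a tensor Markov kernel on
`(0,1)^d`: `p_j` and `q_j` are continuously differentiable, with bounded derivatives, and
solve a common equation `(u_j f')' + v_j f = 0` on `(0,1)`, where `u_j` is continuously
differentiable and `v_j` is continuous on `(0,1)`. -/
structure SturmLiouvilleRegular {d : ℕ} (p q : Fin d → ℝ → ℝ) : Prop where
  p_contDiff : ∀ j, ContDiffOn ℝ 1 (p j) (Ioo (0 : ℝ) 1)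
  q_contDiff : ∀ j, ContDiffOn ℝ 1 (q j) (Ioo (0 : ℝ) 1)
  p_deriv_bdd : ∀ j, ∃ B : ℝ, ∀ t ∈ Ioo (0 : ℝ) 1, |deriv (p j) t| ≤ B
  q_deriv_bdd : ∀ j, ∃ B : ℝ, ∀ t ∈ Ioo (0 : ℝ) 1, |deriv (q j) t| ≤ B
  ode : ∀ j, ∃ u v : ℝ → ℝ, ContDiffOn ℝ 1 u (Ioo (0 : ℝ) 1) ∧
    ContinuousOn v (Ioo (0 : ℝ) 1) ∧
    SolvesSturmLiouville u v (p j) ∧ SolvesSturmLiouville u v (q j)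

/-- `Y` is, on the set `S`, a zero mean Gaussian process with covariance function `k`. -/
structure IsCenteredGP {d : ℕ} {Ω : Type*} [MeasurableSpace Ω] (S : Set (Fin d → ℝ))
    (k : (Fin d → ℝ) → (Fin d → ℝ) → ℝ) (Y : (Fin d → ℝ) → Ω → ℝ) (P : Measure Ω) : Prop where
  gaussian : IsGaussianProcess (fun z : S => Y z) P
  mean_zero : ∀ z ∈ S, ∫ ω, Y z ω ∂P = 0
  cov_eq : ∀ z ∈ S, ∀ z' ∈ S, covariance (Y z) (Y z') P = k z z'

/-! ### Sparse grids -/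

/-- The dyadic one-dimensional design `{i * 2^{-l} : 1 ≤ i ≤ 2^l - 1}`. -/
def dyadicGrid (l : ℕ) : Finset ℝ :=
  (Finset.Icc 1 (2 ^ l - 1)).image (fun i : ℕ => (i : ℝ) / 2 ^ l)

/-- The level vectors `l` with all `l_j ≥ 1` and `l_1 + ... + l_d ≤ τ + d - 1`. -/
def sparseLevels (d τ : ℕ) : Finset (Fin d → ℕ) :=
  (Fintype.piFinset fun _ => Finset.Icc 1 (τ + d - 1)).filter
    (fun l => ∑ j, l j ≤ τ + d - 1)

/-- The classical sparse grid of level `τ` in dimension `d`. -/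
def sparseGrid (d τ : ℕ) : Finset (Fin d → ℝ) :=
  (sparseLevels d τ).biUnion (fun l => Fintype.piFinset fun j => dyadicGrid (l j))

/-- `X` is a truncated sparse grid of size `n`: the union of the classical sparse grid of the
level `τ` determined by `n`, and of an arbitrary set of the right number of points of the
classical sparse grid of level `τ + 1` that are not in the one of level `τ`. -/
def IsTruncatedSparseGrid (d n : ℕ) (X : Finset (Fin d → ℝ)) : Prop :=
  ∃ τ : ℕ, 1 ≤ τ ∧ (sparseGrid d τ).card ≤ n ∧ n < (sparseGrid d (τ + 1)).card ∧
    ∃ A : Finset (Fin d → ℝ), A ⊆ sparseGrid d (τ + 1) \ sparseGrid d τ ∧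
      A.card = n - (sparseGrid d τ).card ∧ X = sparseGrid d τ ∪ A

/-! ### Stochastic kriging -/

/-- The kernel matrix, with entries `k(x_i, x_j)`. -/
def kernelMatrix {d n : ℕ} (k : (Fin d → ℝ) → (Fin d → ℝ) → ℝ) (x : Fin n → Fin d → ℝ) :
    Matrix (Fin n) (Fin n) ℝ :=
  Matrix.of fun i j => k (x i) (x j)

/-- The covariance matrix of the averaged noise, `diag (σ²(x_i) / m_i)`. -/
def noiseMatrix {d n : ℕ} (σ : (Fin d → ℝ) → ℝ) (x : Fin n → Fin d → ℝ) (m : Fin n → ℕ) :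
    Matrix (Fin n) (Fin n) ℝ :=
  Matrix.diagonal fun i => σ (x i) ^ 2 / (m i : ℝ)

/-- The averaged simulation outputs `m_i⁻¹ ∑_{r < m_i} (Y(x_i) + ε_r(x_i))`. -/
def sampleMean {d n : ℕ} {Ω : Type*} (x : Fin n → Fin d → ℝ) (m : Fin n → ℕ)
    (Y : (Fin d → ℝ) → Ω → ℝ) (ε : Fin n → ℕ → Ω → ℝ) (ω : Ω) (i : Fin n) : ℝ :=
  (m i : ℝ)⁻¹ * ∑ r ∈ Finset.range (m i), (Y (x i) ω + ε i r ω)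

/-- The stochastic kriging predictor `k(z)ᵀ (K + Σ)⁻¹ Ybar` at `z`. -/
def skPredictor {d n : ℕ} {Ω : Type*} (k : (Fin d → ℝ) → (Fin d → ℝ) → ℝ)
    (σ : (Fin d → ℝ) → ℝ) (x : Fin n → Fin d → ℝ) (m : Fin n → ℕ)
    (Y : (Fin d → ℝ) → Ω → ℝ) (ε : Fin n → ℕ → Ω → ℝ) (z : Fin d → ℝ) (ω : Ω) : ℝ :=
  (fun i => k z (x i)) ⬝ᵥ
    ((kernelMatrix k x + noiseMatrix σ x m)⁻¹.mulVec (sampleMean x m Y ε ω))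

/-- `ε i r`, for `i < n` and `r < m_i`, is the noise of the `r`-th replication at `x_i`: these
variables are independent, centred Gaussian with variance `σ²(x_i)`, and jointly independent of
the process `Y` on the unit cube. -/
structure IsSimulationNoise {d n : ℕ} {Ω : Type*} [MeasurableSpace Ω] (σ : (Fin d → ℝ) → ℝ)
    (x : Fin n → Fin d → ℝ) (m : Fin n → ℕ) (Y : (Fin d → ℝ) → Ω → ℝ)
    (ε : Fin n → ℕ → Ω → ℝ) (P : Measure Ω) : Prop where
  law : ∀ i, ∀ r < m i, HasLaw (ε i r) (gaussianReal 0 (Real.toNNReal (σ (x i) ^ 2))) P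
  indep : iIndepFun (fun a : (i : Fin n) × Fin (m i) => ε a.1 a.2) P
  indep_process : IndepFun (fun ω (a : (i : Fin n) × Fin (m i)) => ε a.1 a.2 ω)
    (fun ω (z : unitCube d) => Y z ω) P

/-- The noise level `max_i m_i^{-1/2} σ(x_i)`. -/
def maxNoise {d n : ℕ} (σ : (Fin d → ℝ) → ℝ) (x : Fin n → Fin d → ℝ) (m : Fin n → ℕ) : ℝ :=
  ⨆ i : Fin n, (m i : ℝ) ^ (-(1 / 2) : ℝ) * σ (x i)

end SparseKriging

end

namespace SparseKriging

/-! ### Sums over level vectors -/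

/-! The averaged outputs have covariance `K + Σ`, which is positive definite, so the kriging weights
minimise the mean squared error among all linear predictors (`quadraticRisk_le`,
`integral_sq_skPredictor_le`). It therefore suffices to exhibit one good linear predictor on the
classical sparse grid of level `τ` inside the design; extra design points cannot hurt.

The competitor is the Smolyak combination of piecewise constant interpolants: at level `l` each
coordinate of `z` is replaced by a dyadic node within `2^{-l}`. Taking `z` itself as the node of
level `τ + 1` makes the combination over the full box of levels equal to `Y z`, so the noiseless
error is, up to sign, the sum of the tensor differences whose level is outside the sparse index set.
Their covariances factor over coordinates. Since the one-dimensional kernels are Lipschitz, each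
factor is at most `6C min(2^{-l}, 2^{-l'})` (`abs_diffCov_le`), and a Schur-type argument
(`sum_prod_min_half_pow_le`) reduces the variance to a multiple of `∑ 2^{-|l|}` over `|l| ≥ τ + d`,
of order `τ^{d-1} 2^{-τ}`. As `n` is at most of order `τ^{d-1} 2^τ` and `τ` is at most of order `log
n`, this gives `n⁻¹ (log n)^{2(d-1)}`.

The weights have total mass of order at most `τ^d`, so the noise adds at most a constant times the
square of `s = (log n)^d max_i m_i^{-1/2} σ(x_i)`. Eventually `s ≤ 1`, hence `s² ≤ s`. -/

lemma sum_level_le {e L : ℕ} (T : Finset (Fin (e + 1) → ℕ))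
    (hT : T ⊆ Fintype.piFinset fun _ => Finset.Icc 1 L) (g : ℕ → ℝ) (hg : ∀ s, 0 ≤ g s) :
    ∑ l ∈ T, g (∑ j, l j) ≤ (L : ℝ) ^ e * ∑ s ∈ T.image (fun l => ∑ j, l j), g s := by
  classical
  have hmaps : ∀ l ∈ T, Fin.tail l ∈ Fintype.piFinset fun _ : Fin e => Finset.Icc 1 L := by
    intro l hl
    have := hT hl
    rw [Fintype.mem_piFinset] at this ⊢
    intro j
    exact this j.succ
  -- There are at most `L ^ e` choices for the last `e` coordinates. Once these are fixed, the total
  -- level determines the first coordinate, so no total is repeated within a fibre.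
  rw [← Finset.sum_fiberwise_of_maps_to hmaps]
  have hcard : (L : ℝ) ^ e = ((Fintype.piFinset fun _ : Fin e => Finset.Icc 1 L).card : ℝ) := by
    simp [Fintype.card_piFinset]
  rw [hcard, ← nsmul_eq_mul]
  refine Finset.sum_le_card_nsmul _ _ _ fun r _ => ?_
  have hinj : Set.InjOn (fun l : Fin (e + 1) → ℕ => ∑ j, l j)
      (T.filter fun l => Fin.tail l = r) := by
    intro l hl l' hl' h
    simp only [Finset.coe_filter, Set.mem_ofPred_eq] at hl hl'
    simp only [Fin.sum_univ_succ] at h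
    have ht : Fin.tail l = Fin.tail l' := hl.2.trans hl'.2.symm
    have ht' : ∀ j : Fin e, l j.succ = l' j.succ := fun j => congrFun ht j
    have h0 : l 0 = l' 0 := by simpa [ht'] using h
    funext j
    refine Fin.cases h0 ht' j
  rw [← Finset.sum_image (f := g) hinj]
  exact Finset.sum_le_sum_of_subset_of_nonneg (Finset.image_subset_image (Finset.filter_subset _ _))
    fun s _ _ => hg s

lemma sum_half_pow_le (S : Finset ℕ) (N : ℕ) (hS : ∀ s ∈ S, N ≤ s) :
    ∑ s ∈ S, (1 / 2 : ℝ) ^ s ≤ 2 * (1 / 2) ^ N := by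
  classical
  have hinj : Set.InjOn (fun s => s - N) (S : Set ℕ) := by
    intro a ha b hb h
    have := hS a ha
    have := hS b hb
    simp only at h
    omega
  have h1 : ∑ s ∈ S, (1 / 2 : ℝ) ^ s
      = (1 / 2) ^ N * ∑ t ∈ S.image (fun s => s - N), (1 / 2 : ℝ) ^ t := by
    rw [Finset.sum_image hinj, Finset.mul_sum]
    refine Finset.sum_congr rfl fun s hs => ?_
    rw [← pow_add, Nat.add_sub_cancel' (hS s hs)]
  have h2 : ∑ t ∈ S.image (fun s => s - N), (1 / 2 : ℝ) ^ t ≤ 2 := by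
    exact (summable_geometric_two.sum_le_tsum _ fun _ _ => by positivity).trans
      tsum_geometric_two.le
  rw [h1, mul_comm]
  gcongr

lemma sum_half_pow_level_le {e L N : ℕ} (T : Finset (Fin (e + 1) → ℕ))
    (hT : T ⊆ Fintype.piFinset fun _ => Finset.Icc 1 L) (hN : ∀ l ∈ T, N ≤ ∑ j, l j) :
    ∑ l ∈ T, (1 / 2 : ℝ) ^ (∑ j, l j) ≤ (L : ℝ) ^ e * (2 * (1 / 2) ^ N) := by
  refine (sum_level_le T hT (fun s => (1 / 2 : ℝ) ^ s) fun s => by positivity).trans ?_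
  gcongr
  refine sum_half_pow_le _ _ fun s hs => ?_
  obtain ⟨l, hl, rfl⟩ := Finset.mem_image.1 hs
  exact hN l hl

lemma sum_two_pow_level_le {e L N : ℕ} (T : Finset (Fin (e + 1) → ℕ))
    (hT : T ⊆ Fintype.piFinset fun _ => Finset.Icc 1 L) (hN : ∀ l ∈ T, ∑ j, l j ≤ N) :
    ∑ l ∈ T, (2 : ℝ) ^ (∑ j, l j) ≤ (L : ℝ) ^ e * 2 ^ (N + 1) := by
  refine (sum_level_le T hT (fun s => (2 : ℝ) ^ s) fun s => by positivity).trans ?_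
  gcongr
  calc ∑ s ∈ T.image (fun l => ∑ j, l j), (2 : ℝ) ^ s
      ≤ ∑ s ∈ Finset.range (N + 1), (2 : ℝ) ^ s := by
        refine Finset.sum_le_sum_of_subset_of_nonneg ?_ fun _ _ _ => by positivity
        intro s hs
        obtain ⟨l, hl, rfl⟩ := Finset.mem_image.1 hs
        have := hN l hl
        rw [Finset.mem_range]
        omega
    _ ≤ 2 ^ (N + 1) := by
        rw [geom_sum_eq (by norm_num)]
        norm_num

/-! ### Cardinality of sparse grids -/

lemma mem_Ioo_of_mem_dyadicGrid {l : ℕ} {t : ℝ} (ht : t ∈ dyadicGrid l) : t ∈ Ioo (0 : ℝ) 1 := by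
  obtain ⟨i, hi, rfl⟩ := Finset.mem_image.1 ht
  rw [Finset.mem_Icc] at hi
  have h2 : (0 : ℝ) < 2 ^ l := by positivity
  refine ⟨div_pos (by exact_mod_cast hi.1) h2, ?_⟩
  rw [div_lt_one h2]
  have : i < 2 ^ l := by
    have := Nat.one_le_two_pow (n := l)
    omega
  exact_mod_cast this

lemma card_dyadicGrid (l : ℕ) : (dyadicGrid l).card = 2 ^ l - 1 := by
  rw [dyadicGrid, Finset.card_image_of_injective, Nat.card_Icc, Nat.add_sub_cancel]
  intro a b h
  have h2 : (2 : ℝ) ^ l ≠ 0 := by positivity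
  simp only [div_left_inj' h2] at h
  exact_mod_cast h

lemma exists_mem_dyadicGrid {l : ℕ} (hl : 1 ≤ l) {t : ℝ} (ht : t ∈ Ioo (0 : ℝ) 1) :
    ∃ a ∈ dyadicGrid l, |a - t| ≤ (1 / 2) ^ l := by
  have h2 : (0 : ℝ) < 2 ^ l := by positivity
  have hhalf : ((1 : ℝ) / 2) ^ l = 1 / 2 ^ l := by rw [div_pow, one_pow]
  have htl : 0 < t * 2 ^ l := mul_pos ht.1 h2
  have hfl := Nat.floor_le htl.le
  have hfu := Nat.lt_floor_add_one (t * 2 ^ l)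
  have hlt : ⌊t * 2 ^ l⌋₊ < 2 ^ l := by
    rw [Nat.floor_lt htl.le]
    push_cast
    nlinarith [ht.2]
  have htwo : 2 ≤ 2 ^ l := by
    calc 2 = 2 ^ 1 := by norm_num
      _ ≤ 2 ^ l := Nat.pow_le_pow_right (by norm_num) hl
  -- The endpoint `0` is not in the grid, so a vanishing floor is replaced by `1`; the distance to
  -- `t` stays at most `2^{-l}`.
  refine ⟨((max ⌊t * 2 ^ l⌋₊ 1 : ℕ) : ℝ) / 2 ^ l, Finset.mem_image_of_mem _ ?_, ?_⟩
  · rw [Finset.mem_Icc]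
    omega
  · have : ((max ⌊t * 2 ^ l⌋₊ 1 : ℕ) : ℝ) / 2 ^ l - t
        = (((max ⌊t * 2 ^ l⌋₊ 1 : ℕ) : ℝ) - t * 2 ^ l) / 2 ^ l := by
      field_simp
    rw [this, abs_div, abs_of_pos h2, hhalf]
    refine div_le_div_of_nonneg_right ?_ h2.le
    rcases Nat.eq_zero_or_pos ⌊t * 2 ^ l⌋₊ with h0 | h0
    · rw [h0] at hfu ⊢
      simp only [Nat.cast_zero, zero_add] at hfu
      simp only [zero_le, max_eq_right, Nat.cast_one]
      rw [abs_le]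
      constructor <;> linarith
    · rw [max_eq_left h0, abs_le]
      constructor <;> linarith

lemma sparseGrid_subset_unitCube {d τ : ℕ} {z : Fin d → ℝ} (hz : z ∈ sparseGrid d τ) :
    z ∈ unitCube d := by
  obtain ⟨l, -, hl⟩ := Finset.mem_biUnion.1 hz
  exact fun j => mem_Ioo_of_mem_dyadicGrid (Fintype.mem_piFinset.1 hl j)

/-- Union bound: the full grid of multi-level `l` has at most `2^{|l|}` points, and `|l| ≤ τ + e`.
-/
lemma card_sparseGrid_le (e τ : ℕ) :
    ((sparseGrid (e + 1) τ).card : ℝ) ≤ ((τ + e : ℕ) : ℝ) ^ e * 2 ^ (τ + e + 1) := by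
  have h1 : ((sparseGrid (e + 1) τ).card : ℝ)
      ≤ ∑ l ∈ sparseLevels (e + 1) τ, (2 : ℝ) ^ (∑ j, l j) := by
    calc ((sparseGrid (e + 1) τ).card : ℝ)
        ≤ ((∑ l ∈ sparseLevels (e + 1) τ,
            (Fintype.piFinset fun j => dyadicGrid (l j)).card : ℕ) : ℝ) := by
          exact_mod_cast Finset.card_biUnion_le
      _ ≤ _ := by
          push_cast
          refine Finset.sum_le_sum fun l _ => ?_
          rw [Fintype.card_piFinset]
          push_cast
          rw [← Finset.prod_pow_eq_pow_sum]
          refine Finset.prod_le_prod (fun _ _ => by positivity) fun j _ => ?_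
          rw [card_dyadicGrid]
          exact_mod_cast Nat.sub_le _ _
  refine h1.trans (sum_two_pow_level_le _ (Finset.filter_subset _ _) fun l hl => ?_)
  exact (Finset.mem_filter.1 hl).2

/-- The points with all coordinates but the first equal to `1/2` already form a copy of the
one-dimensional grid of level `τ`. This is what bounds `τ` by a multiple of `log n`. -/
lemma two_pow_le_card_sparseGrid (e : ℕ) {τ : ℕ} (hτ : 1 ≤ τ) :
    2 ^ τ - 1 ≤ (sparseGrid (e + 1) τ).card := by
  classical
  rw [← card_dyadicGrid]
  refine le_trans (Finset.card_le_card ?_)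
    (Finset.card_image_le (s := sparseGrid (e + 1) τ) (f := fun z => z 0))
  intro t ht
  have hhalf : (1 / 2 : ℝ) ∈ dyadicGrid 1 := by simp [dyadicGrid]
  refine Finset.mem_image.2 ⟨Fin.cons t fun _ => 1 / 2, ?_, by simp⟩
  refine Finset.mem_biUnion.2 ⟨Fin.cons τ fun _ => 1, ?_, ?_⟩
  · refine Finset.mem_filter.2 ⟨Fintype.mem_piFinset.2 fun j => ?_, ?_⟩
    · refine Fin.cases ?_ (fun i => ?_) j
      · simp [hτ]
      · simp; omega
    · simp [Fin.sum_univ_succ]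
  · refine Fintype.mem_piFinset.2 fun j => ?_
    refine Fin.cases ?_ (fun i => ?_) j
    · simpa using ht
    · simpa using hhalf

lemma IsTruncatedSparseGrid.card_eq {d n : ℕ} {X : Finset (Fin d → ℝ)}
    (h : IsTruncatedSparseGrid d n X) : X.card = n := by
  obtain ⟨τ, -, h1, -, A, hA, hc, rfl⟩ := h
  rw [Finset.card_union_of_disjoint, hc]
  · omega
  · exact Finset.disjoint_of_subset_right hA Finset.disjoint_sdiff

lemma IsTruncatedSparseGrid.subset_unitCube {d n : ℕ} {X : Finset (Fin d → ℝ)}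
    (h : IsTruncatedSparseGrid d n X) {z : Fin d → ℝ} (hz : z ∈ X) : z ∈ unitCube d := by
  obtain ⟨τ, -, -, -, A, hA, -, rfl⟩ := h
  rcases Finset.mem_union.1 hz with hz | hz
  · exact sparseGrid_subset_unitCube hz
  · exact sparseGrid_subset_unitCube (Finset.mem_sdiff.1 (hA hz)).1

/-! ### Summation over pairs of level vectors -/

lemma sum_three_quarters_pow_dist_le (S : Finset ℕ) (a : ℕ) :
    ∑ b ∈ S, (3 / 4 : ℝ) ^ ((a - b) + (b - a)) ≤ 8 := by
  classical
  have hs : Summable fun n : ℕ => (3 / 4 : ℝ) ^ n :=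
    summable_geometric_of_lt_one (by norm_num) (by norm_num)
  have ht : ∑' n : ℕ, (3 / 4 : ℝ) ^ n = 4 := by
    rw [tsum_geometric_of_lt_one (by norm_num) (by norm_num)]; norm_num
  rw [← Finset.sum_filter_add_sum_filter_not S (fun b => b ≤ a)]
  have h1 : ∑ b ∈ S with b ≤ a, (3 / 4 : ℝ) ^ ((a - b) + (b - a)) ≤ 4 := by
    have hinj : Set.InjOn (fun b => (a - b) + (b - a)) (S.filter fun b => b ≤ a) := by
      intro b hb c hc h
      simp only [Finset.coe_filter, Set.mem_ofPred_eq] at hb hc h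
      omega
    rw [← Finset.sum_image (f := fun n => (3 / 4 : ℝ) ^ n) hinj]
    exact (hs.sum_le_tsum _ fun _ _ => by positivity).trans ht.le
  have h2 : ∑ b ∈ S with ¬ b ≤ a, (3 / 4 : ℝ) ^ ((a - b) + (b - a)) ≤ 4 := by
    have hinj : Set.InjOn (fun b => (a - b) + (b - a)) (S.filter fun b => ¬ b ≤ a) := by
      intro b hb c hc h
      simp only [Finset.coe_filter, Set.mem_ofPred_eq] at hb hc h
      omega
    rw [← Finset.sum_image (f := fun n => (3 / 4 : ℝ) ^ n) hinj]
    exact (hs.sum_le_tsum _ fun _ _ => by positivity).trans ht.le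
  linarith

/-- The squared minimum is `2^{-a} 2^{-b} 2^{-|a-b|}`, and `1/2 ≤ (3/4)²` splits the last factor
symmetrically without square roots. With truncated subtraction, `(a - b) + (b - a)` is `|a - b|`. -/
lemma sq_min_half_pow_le (a b : ℕ) :
    (min ((1 / 2 : ℝ) ^ a) ((1 / 2) ^ b)) ^ 2
      ≤ ((1 / 2) ^ a * (3 / 4) ^ ((a - b) + (b - a)))
        * ((1 / 2) ^ b * (3 / 4) ^ ((b - a) + (a - b))) := by
  have key : ∀ a c : ℕ, ((1 / 2 : ℝ) ^ (a + c)) ^ 2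
      ≤ ((1 / 2) ^ a * (3 / 4) ^ c) * ((1 / 2) ^ (a + c) * (3 / 4) ^ c) := by
    intro a c
    have h : (1 / 2 : ℝ) ^ c ≤ (3 / 4) ^ c * (3 / 4) ^ c := by
      rw [← mul_pow]
      exact pow_le_pow_left₀ (by norm_num) (by norm_num) c
    calc ((1 / 2 : ℝ) ^ (a + c)) ^ 2 = (1 / 2) ^ a * (1 / 2) ^ (a + c) * (1 / 2) ^ c := by ring
      _ ≤ (1 / 2) ^ a * (1 / 2) ^ (a + c) * ((3 / 4) ^ c * (3 / 4) ^ c) := by gcongr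
      _ = _ := by ring
  rcases le_total a b with h | h
  · obtain ⟨c, rfl⟩ := Nat.exists_eq_add_of_le h
    have := key a c
    have hmin : min ((1 / 2 : ℝ) ^ a) ((1 / 2) ^ (a + c)) = (1 / 2) ^ (a + c) :=
      min_eq_right (pow_le_pow_of_le_one (by norm_num) (by norm_num) h)
    rw [hmin]
    simpa using this
  · obtain ⟨c, rfl⟩ := Nat.exists_eq_add_of_le h
    have := key b c
    have hmin : min ((1 / 2 : ℝ) ^ (b + c)) ((1 / 2) ^ b) = (1 / 2) ^ (b + c) :=
      min_eq_left (pow_le_pow_of_le_one (by norm_num) (by norm_num) h)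
    rw [hmin, mul_comm]
    simpa using this

/-- A Schur test. The product of minima is at most the geometric, hence the arithmetic, mean of `A l
l'` and `A l' l`. Off-diagonal decay of `A` makes each row sum at most `8^d 2^{-|l|}`, so the double
sum costs only a constant over the single one. -/
lemma sum_prod_min_half_pow_le {d L : ℕ} (T : Finset (Fin d → ℕ))
    (hT : T ⊆ Fintype.piFinset fun _ => Finset.Icc 1 L) :
    ∑ l ∈ T, ∑ l' ∈ T, ∏ j, min ((1 / 2 : ℝ) ^ l j) ((1 / 2) ^ l' j)
      ≤ 8 ^ d * ∑ l ∈ T, (1 / 2 : ℝ) ^ (∑ j, l j) := by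
  classical
  set A : (Fin d → ℕ) → (Fin d → ℕ) → ℝ := fun l l' =>
    ∏ j, ((1 / 2 : ℝ) ^ l j * (3 / 4) ^ ((l j - l' j) + (l' j - l j))) with hA
  have hpt : ∀ l l', ∏ j, min ((1 / 2 : ℝ) ^ l j) ((1 / 2) ^ l' j) ≤ (A l l' + A l' l) / 2 := by
    intro l l'
    have h0 : 0 ≤ A l l' := by positivity
    have h0' : 0 ≤ A l' l := by positivity
    have hsq : (∏ j, min ((1 / 2 : ℝ) ^ l j) ((1 / 2) ^ l' j)) ^ 2 ≤ A l l' * A l' l := by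
      rw [hA, ← Finset.prod_pow, ← Finset.prod_mul_distrib]
      exact Finset.prod_le_prod (fun _ _ => by positivity) fun j _ => sq_min_half_pow_le _ _
    refine abs_le_of_sq_le_sq' ?_ (by positivity) |>.2
    nlinarith [sq_nonneg (A l l' - A l' l)]
  have hrow : ∀ l, ∑ l' ∈ T, A l l' ≤ 8 ^ d * (1 / 2 : ℝ) ^ (∑ j, l j) := by
    intro l
    calc ∑ l' ∈ T, A l l'
        ≤ ∑ l' ∈ Fintype.piFinset fun _ : Fin d => Finset.Icc 1 L, A l l' :=
          Finset.sum_le_sum_of_subset_of_nonneg hT fun _ _ _ => by positivity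
      _ = ∏ j, ∑ b ∈ Finset.Icc 1 L, ((1 / 2 : ℝ) ^ l j * (3 / 4) ^ ((l j - b) + (b - l j))) := by
          rw [Finset.prod_univ_sum]
      _ ≤ ∏ j, ((1 / 2 : ℝ) ^ l j * 8) := by
          refine Finset.prod_le_prod (fun _ _ => by positivity) fun j _ => ?_
          rw [← Finset.mul_sum]
          gcongr
          exact sum_three_quarters_pow_dist_le _ _
      _ = 8 ^ d * (1 / 2 : ℝ) ^ (∑ j, l j) := by
          rw [Finset.prod_mul_distrib, Finset.prod_pow_eq_pow_sum]
          simp [mul_comm]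
  calc _ ≤ ∑ l ∈ T, ∑ l' ∈ T, (A l l' + A l' l) / 2 :=
        Finset.sum_le_sum fun l _ => Finset.sum_le_sum fun l' _ => hpt l l'
    _ = ((∑ l ∈ T, ∑ l' ∈ T, A l l') + ∑ l ∈ T, ∑ l' ∈ T, A l' l) / 2 := by
        simp only [← Finset.sum_div, Finset.sum_add_distrib]
    _ = ∑ l ∈ T, ∑ l' ∈ T, A l l' := by
        rw [Finset.sum_comm (f := fun l l' => A l' l)]
        ring
    _ ≤ _ := by
        rw [Finset.mul_sum]
        exact Finset.sum_le_sum fun l _ => hrow l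

/-! ### The one-dimensional Markov kernels -/

/-- The one-dimensional Markov kernel `p (s ∧ t) * q (s ∨ t)`. -/
def markovKernel (p q : ℝ → ℝ) (s t : ℝ) : ℝ := p (min s t) * q (max s t)

lemma markovKernel_comm (p q : ℝ → ℝ) (s t : ℝ) :
    markovKernel p q s t = markovKernel p q t s := by
  rw [markovKernel, markovKernel, min_comm, max_comm]

lemma tmKernel_eq_prod {d : ℕ} (p q : Fin d → ℝ → ℝ) (x y : Fin d → ℝ) :
    tmKernel p q x y = ∏ j, markovKernel (p j) (q j) (x j) (y j) := rfl

lemma tmKernel_comm {d : ℕ} (p q : Fin d → ℝ → ℝ) (x y : Fin d → ℝ) :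
    tmKernel p q x y = tmKernel p q y x := by
  simp only [tmKernel_eq_prod, markovKernel_comm]

lemma exists_lipschitz_of_deriv_bdd {f : ℝ → ℝ} (hf : ContDiffOn ℝ 1 f (Ioo 0 1))
    (hb : ∃ B : ℝ, ∀ t ∈ Ioo (0 : ℝ) 1, |deriv f t| ≤ B) :
    ∃ C : ℝ, 0 < C ∧ (∀ t ∈ Ioo (0 : ℝ) 1, |f t| ≤ C) ∧
      ∀ s ∈ Ioo (0 : ℝ) 1, ∀ t ∈ Ioo (0 : ℝ) 1, |f s - f t| ≤ C * |s - t| := by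
  obtain ⟨B, hB⟩ := hb
  have hhalf : (1 / 2 : ℝ) ∈ Ioo (0 : ℝ) 1 := by constructor <;> norm_num
  have hB0 : 0 ≤ B := (abs_nonneg _).trans (hB _ hhalf)
  have hlip : ∀ s ∈ Ioo (0 : ℝ) 1, ∀ t ∈ Ioo (0 : ℝ) 1, |f s - f t| ≤ B * |s - t| := by
    intro s hs t ht
    refine (convex_Ioo (0 : ℝ) 1).norm_image_sub_le_of_norm_deriv_le (f := f)
      (fun x hx => ?_) hB ht hs
    exact (hf.differentiableOn one_ne_zero).differentiableAt (isOpen_Ioo.mem_nhds hx)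
  -- One constant serves as sup bound, through comparison with the midpoint, and as Lipschitz
  -- constant; the `1` keeps it positive.
  refine ⟨B + |f (1 / 2)| + 1, by positivity, fun t ht => ?_, fun s hs t ht => ?_⟩
  · have h1 := hlip t ht _ hhalf
    have h2 : |t - 1 / 2| ≤ 1 := by rw [abs_le]; constructor <;> linarith [ht.1, ht.2]
    have h3 : |f t| ≤ |f t - f (1 / 2)| + |f (1 / 2)| := by
      simpa using abs_add_le (f t - f (1 / 2)) (f (1 / 2))
    nlinarith
  · refine (hlip s hs t ht).trans ?_
    gcongr
    linarith [abs_nonneg (f (1 / 2))]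

/-- A symmetric kernel that is bounded, and Lipschitz in each variable, with constant `C`. -/
structure IsLipschitzKernel (C : ℝ) (k : ℝ → ℝ → ℝ) : Prop where
  symm : ∀ s t, k s t = k t s
  bdd : ∀ s ∈ Ioo (0 : ℝ) 1, ∀ t ∈ Ioo (0 : ℝ) 1, |k s t| ≤ C
  lipschitz : ∀ s ∈ Ioo (0 : ℝ) 1, ∀ s' ∈ Ioo (0 : ℝ) 1, ∀ t ∈ Ioo (0 : ℝ) 1,
    |k s t - k s' t| ≤ C * |s - s'|

lemma IsLipschitzKernel.mono {C C' : ℝ} {k : ℝ → ℝ → ℝ} (h : IsLipschitzKernel C k)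
    (hC : C ≤ C') : IsLipschitzKernel C' k where
  symm := h.symm
  bdd s hs t ht := (h.bdd s hs t ht).trans hC
  lipschitz s hs s' hs' t ht := (h.lipschitz s hs s' hs' t ht).trans (by gcongr)

lemma min_mem_Ioo {s t : ℝ} (hs : s ∈ Ioo (0 : ℝ) 1) (ht : t ∈ Ioo (0 : ℝ) 1) :
    min s t ∈ Ioo (0 : ℝ) 1 := ⟨lt_min hs.1 ht.1, (min_le_left _ _).trans_lt hs.2⟩

lemma max_mem_Ioo {s t : ℝ} (hs : s ∈ Ioo (0 : ℝ) 1) (ht : t ∈ Ioo (0 : ℝ) 1) :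
    max s t ∈ Ioo (0 : ℝ) 1 := ⟨hs.1.trans_le (le_max_left _ _), max_lt hs.2 ht.2⟩

lemma exists_isLipschitzKernel_markovKernel {p q : ℝ → ℝ}
    (hp : ContDiffOn ℝ 1 p (Ioo 0 1)) (hq : ContDiffOn ℝ 1 q (Ioo 0 1))
    (hp' : ∃ B : ℝ, ∀ t ∈ Ioo (0 : ℝ) 1, |deriv p t| ≤ B)
    (hq' : ∃ B : ℝ, ∀ t ∈ Ioo (0 : ℝ) 1, |deriv q t| ≤ B) :
    ∃ C : ℝ, IsLipschitzKernel C (markovKernel p q) := by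
  obtain ⟨A, hA, hpb, hpl⟩ := exists_lipschitz_of_deriv_bdd hp hp'
  obtain ⟨B, hB, hqb, hql⟩ := exists_lipschitz_of_deriv_bdd hq hq'
  refine ⟨2 * (A * B), markovKernel_comm p q, fun s hs t ht => ?_, fun s hs s' hs' t ht => ?_⟩
  · rw [markovKernel, abs_mul]
    have := mul_le_mul (hpb _ (min_mem_Ioo hs ht)) (hqb _ (max_mem_Ioo hs ht)) (abs_nonneg _) hA.le
    nlinarith [mul_pos hA hB]
  · have h1 : |p (min s t) - p (min s' t)| ≤ A * |s - s'| := by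
      refine (hpl _ (min_mem_Ioo hs ht) _ (min_mem_Ioo hs' ht)).trans ?_
      refine mul_le_mul_of_nonneg_left ?_ (by positivity)
      simpa using abs_min_sub_min_le_max s t s' t
    have h2 : |q (max s t) - q (max s' t)| ≤ B * |s - s'| := by
      refine (hql _ (max_mem_Ioo hs ht) _ (max_mem_Ioo hs' ht)).trans ?_
      refine mul_le_mul_of_nonneg_left ?_ (by positivity)
      simpa using abs_max_sub_max_le_max s t s' t
    have h3 : markovKernel p q s t - markovKernel p q s' t
        = (p (min s t) - p (min s' t)) * q (max s t)
          + p (min s' t) * (q (max s t) - q (max s' t)) := by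
      rw [markovKernel, markovKernel]; ring
    rw [h3]
    refine (abs_add_le _ _).trans ?_
    rw [abs_mul, abs_mul]
    have h4 := mul_le_mul h1 (hqb _ (max_mem_Ioo hs ht)) (abs_nonneg _) (by positivity)
    have h5 := mul_le_mul (hpb _ (min_mem_Ioo hs' ht)) h2 (abs_nonneg _) hA.le
    linarith

lemma SturmLiouvilleRegular.exists_isLipschitzKernel {d : ℕ} {p q : Fin d → ℝ → ℝ}
    (h : SturmLiouvilleRegular p q) :
    ∃ C : ℝ, 0 ≤ C ∧ ∀ j, IsLipschitzKernel C (markovKernel (p j) (q j)) := by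
  choose C hC using fun j => exists_isLipschitzKernel_markovKernel (h.p_contDiff j)
    (h.q_contDiff j) (h.p_deriv_bdd j) (h.q_deriv_bdd j)
  refine ⟨∑ j, |C j|, by positivity, fun j => (hC j).mono ?_⟩
  exact (le_abs_self _).trans
    (Finset.single_le_sum (f := fun j => |C j|) (fun _ _ => abs_nonneg _) (Finset.mem_univ j))

/-! ### Positive definiteness -/

/-- A positive, strictly increasing function on a finite set of reals is a sum of positive steps. -/
lemma exists_steps (g : ℝ → ℝ) (S : Finset ℝ) (hpos : ∀ t ∈ S, 0 < g t)
    (hmono : StrictMonoOn g S) :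
    ∃ w : ℝ → ℝ, (∀ u ∈ S, 0 < w u) ∧ ∀ t ∈ S, g t = ∑ u ∈ S, if u ≤ t then w u else 0 := by
  classical
  induction S using Finset.induction_on_max with
  | empty => exact ⟨fun _ => 0, by simp, by simp⟩
  | insert a S hlt ih =>
    obtain ⟨w, hw, hsum⟩ := ih (fun t ht => hpos t (Finset.mem_insert_of_mem ht))
      (hmono.mono (by simp))
    have ha : a ∉ S := fun h => lt_irrefl _ (hlt a h)
    have hne : ∀ u ∈ S, u ≠ a := fun u hu h => ha (h ▸ hu)
    -- The new largest point receives the increment of `g` over the previous maximum, where `g`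
    -- equals the sum of all earlier steps.
    refine ⟨Function.update w a (g a - ∑ u ∈ S, w u), fun u hu => ?_, fun t ht => ?_⟩
    · rcases Finset.mem_insert.1 hu with rfl | hu
      · rw [Function.update_self, sub_pos]
        rcases S.eq_empty_or_nonempty with rfl | hS
        · simpa using hpos u (by simp)
        · have hm := S.max'_mem hS
          have h1 := hsum _ hm
          rw [Finset.sum_congr rfl (fun u hu => if_pos (S.le_max' u hu))] at h1
          rw [← h1]
          exact hmono (by simp [hm]) (by simp) (hlt _ hm)
      · rw [Function.update_of_ne (hne u hu)]
        exact hw u hu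
    · rw [Finset.sum_insert ha, Function.update_self]
      have hcongr : ∀ t, (∑ u ∈ S, if u ≤ t then
          Function.update w a (g a - ∑ u ∈ S, w u) u else 0) = ∑ u ∈ S, if u ≤ t then w u else 0 :=
        fun t => Finset.sum_congr rfl fun u hu => by rw [Function.update_of_ne (hne u hu)]
      rw [hcongr]
      rcases Finset.mem_insert.1 ht with rfl | ht
      · rw [if_pos le_rfl, Finset.sum_congr rfl (fun u hu => if_pos (hlt u hu).le)]
        ring
      · rw [if_neg (not_le.2 (hlt t ht)), zero_add]
        exact hsum t ht

/-- With `g = p / q` the kernel is `q s * q t * g (min s t)`. Writing `g` as a sum of steps and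
using that `u ≤ min s t` means `u ≤ s` and `u ≤ t` separates the variables with positive
coefficients. -/
lemma exists_markovKernel_eq_sum {p q : ℝ → ℝ} (S : Finset ℝ) (hS : ∀ t ∈ S, t ∈ Ioo (0 : ℝ) 1)
    (hp : ∀ t ∈ Ioo (0 : ℝ) 1, 0 < p t) (hq : ∀ t ∈ Ioo (0 : ℝ) 1, 0 < q t)
    (hmono : StrictMonoOn (fun t => p t / q t) (Ioo (0 : ℝ) 1)) :
    ∃ w : ℝ → ℝ, (∀ u ∈ S, 0 < w u) ∧ ∀ s ∈ S, ∀ t ∈ S, markovKernel p q s t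
      = ∑ u ∈ S, w u * ((if u ≤ s then q s else 0) * (if u ≤ t then q t else 0)) := by
  obtain ⟨w, hw, hsum⟩ := exists_steps (fun t => p t / q t) S
    (fun t ht => div_pos (hp t (hS t ht)) (hq t (hS t ht))) (hmono.mono hS)
  have key : ∀ s ∈ S, ∀ t ∈ S, s ≤ t → markovKernel p q s t
      = ∑ u ∈ S, w u * ((if u ≤ s then q s else 0) * (if u ≤ t then q t else 0)) := by
    intro s hs t ht hst
    have h1 := hsum s hs
    rw [div_eq_iff (hq s (hS s hs)).ne'] at h1
    rw [markovKernel, min_eq_left hst, max_eq_right hst, h1, Finset.sum_mul, Finset.sum_mul]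
    refine Finset.sum_congr rfl fun u _ => ?_
    by_cases hu : u ≤ s
    · rw [if_pos hu, if_pos hu, if_pos (hu.trans hst)]; ring
    · simp [hu]
  refine ⟨w, hw, fun s hs t ht => ?_⟩
  rcases le_total s t with h | h
  · exact key s hs t ht h
  · rw [markovKernel_comm, key t ht s hs h]
    exact Finset.sum_congr rfl fun u _ => by ring

/-- The tensorised step expansion makes the quadratic form a positively weighted sum of squares
indexed by the grid of all coordinates. If `x i` is maximal in the coordinatewise order among the
points with `c i ≠ 0`, the square indexed by `u = x i` contains only the term of `i`, so it is
positive. -/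
lemma IsTensorMarkov.posDef_kernelMatrix {d n : ℕ} {p q : Fin d → ℝ → ℝ}
    (h : IsTensorMarkov p q) {x : Fin n → Fin d → ℝ} (hx : ∀ i, x i ∈ unitCube d)
    (hinj : Function.Injective x) : (kernelMatrix (tmKernel p q) x).PosDef := by
  classical
  set S : Fin d → Finset ℝ := fun j => Finset.univ.image fun i => x i j with hSdef
  have hS : ∀ j, ∀ t ∈ S j, t ∈ Ioo (0 : ℝ) 1 := by
    intro j t ht
    obtain ⟨i, -, rfl⟩ := Finset.mem_image.1 ht
    exact hx i j
  have hxS : ∀ i j, x i j ∈ S j := fun i j => Finset.mem_image_of_mem _ (Finset.mem_univ i)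
  choose w hw hk using fun j => exists_markovKernel_eq_sum (S j) (hS j) (h.p_pos j) (h.q_pos j)
    (h.strictMono j)
  set φ : (Fin d → ℝ) → Fin n → ℝ := fun u i => ∏ j, if u j ≤ x i j then q j (x i j) else 0
    with hφ
  have hker : ∀ i i', tmKernel p q (x i) (x i')
      = ∑ u ∈ Fintype.piFinset S, (∏ j, w j (u j)) * (φ u i * φ u i') := by
    intro i i'
    rw [tmKernel_eq_prod, Finset.prod_congr rfl fun j _ => hk j _ (hxS i j) _ (hxS i' j),
      Finset.prod_univ_sum]
    simp only [Finset.prod_mul_distrib, hφ]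
  have hφ0 : ∀ u i, ¬ u ≤ x i → φ u i = 0 := by
    intro u i hu
    obtain ⟨j, hj⟩ := not_forall.1 hu
    exact Finset.prod_eq_zero (Finset.mem_univ j) (if_neg hj)
  have hφ1 : ∀ i, φ (x i) i ≠ 0 := by
    intro i
    rw [hφ]
    simp only [le_refl, if_true]
    exact Finset.prod_ne_zero_iff.2 fun j _ => (h.q_pos j _ (hx i j)).ne'
  refine Matrix.PosDef.of_dotProduct_mulVec_pos ?_ fun c hc => ?_
  · ext i j
    simp [kernelMatrix, tmKernel_comm]
  · have hform : star c ⬝ᵥ (kernelMatrix (tmKernel p q) x).mulVec c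
        = ∑ u ∈ Fintype.piFinset S, (∏ j, w j (u j)) * (∑ i, c i * φ u i) ^ 2 := by
      simp only [dotProduct, Matrix.mulVec, kernelMatrix, Matrix.of_apply, hker, star_trivial,
        Finset.mul_sum, Finset.sum_mul, sq]
      rw [Finset.sum_congr rfl fun i _ => Finset.sum_comm, Finset.sum_comm]
      refine Finset.sum_congr rfl fun u _ => Finset.sum_congr rfl fun i _ =>
        Finset.sum_congr rfl fun i' _ => by ring
    rw [hform]
    have hwpos : ∀ u ∈ Fintype.piFinset S, 0 < ∏ j, w j (u j) := fun u hu =>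
      Finset.prod_pos fun j _ => hw j _ (Fintype.mem_piFinset.1 hu j)
    obtain ⟨i₀, hi₀⟩ := Function.ne_iff.1 hc
    obtain ⟨i, hi⟩ := (Finset.univ.filter fun i => c i ≠ 0).exists_maximalFor x
      ⟨i₀, by simpa using hi₀⟩
    have hci : c i ≠ 0 := by simpa using hi.1
    refine Finset.sum_pos' (fun u hu => mul_nonneg (hwpos u hu).le (sq_nonneg _)) ⟨x i, ?_, ?_⟩
    · exact Fintype.mem_piFinset.2 (hxS i)
    · refine mul_pos (hwpos _ (Fintype.mem_piFinset.2 (hxS i)))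
        (pow_pos ?_ 2 |>.trans_eq (sq_abs _))
      rw [abs_pos, Finset.sum_eq_single i]
      · exact mul_ne_zero hci (hφ1 i)
      · intro b _ hb
        by_cases hcb : c b = 0
        · rw [hcb, zero_mul]
        · rw [hφ0, mul_zero]
          intro hle
          exact hb (hinj (le_antisymm (hi.2 (by simpa using hcb) hle) hle))
      · simp

/-! ### The Smolyak combination -/

/-- The coefficient of the `m`-th approximation in the `l`-th hierarchical difference, where
the `0`-th approximation vanishes. -/
def diffCoeff (l m : ℕ) : ℝ := (if m = l then 1 else 0) - if m + 1 = l then 1 else 0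

lemma sum_diffCoeff_left {L m : ℕ} (hm : m ∈ Finset.Icc 1 L) :
    ∑ l ∈ Finset.Icc 1 L, diffCoeff l m = if m = L then 1 else 0 := by
  rw [Finset.mem_Icc] at hm
  simp only [diffCoeff, Finset.sum_sub_distrib, Finset.sum_ite_eq, Finset.mem_Icc]
  by_cases h : m = L
  · subst h; simp [hm.1]
  · have h' : m + 1 ≤ L := by omega
    simp [hm.1, hm.2, h, h']

lemma sum_abs_diffCoeff_le (L l : ℕ) : ∑ m ∈ Finset.Icc 1 L, |diffCoeff l m| ≤ 2 := by
  have h1 : ∑ m ∈ Finset.Icc 1 L, (if m = l then (1 : ℝ) else 0) ≤ 1 := by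
    rw [Finset.sum_ite_eq']; split_ifs <;> norm_num
  have h2 : ∑ m ∈ Finset.Icc 1 L, (if m + 1 = l then (1 : ℝ) else 0) ≤ 1 := by
    calc ∑ m ∈ Finset.Icc 1 L, (if m + 1 = l then (1 : ℝ) else 0)
        ≤ ∑ m ∈ Finset.Icc 1 L, (if m = l - 1 then (1 : ℝ) else 0) := by
          refine Finset.sum_le_sum fun m _ => ?_
          by_cases h : m + 1 = l
          · rw [if_pos h, if_pos (by omega)]
          · rw [if_neg h]; split_ifs <;> norm_num
      _ ≤ 1 := by rw [Finset.sum_ite_eq']; split_ifs <;> norm_num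
  calc ∑ m ∈ Finset.Icc 1 L, |diffCoeff l m|
      ≤ ∑ m ∈ Finset.Icc 1 L, ((if m = l then (1 : ℝ) else 0) + if m + 1 = l then 1 else 0) := by
        refine Finset.sum_le_sum fun m _ => ?_
        rw [diffCoeff]
        split_ifs <;> norm_num
    _ ≤ 2 := by rw [Finset.sum_add_distrib]; linarith

lemma diffCoeff_eq_zero {l m : ℕ} (h : l < m) : diffCoeff l m = 0 := by
  rw [diffCoeff, if_neg (by omega), if_neg (by omega), sub_zero]

lemma sum_diffCoeff_mul {L l : ℕ} (hl : l ∈ Finset.Icc 1 L) (f : ℕ → ℝ) :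
    ∑ m ∈ Finset.Icc 1 L, diffCoeff l m * f m = if l = 1 then f 1 else f l - f (l - 1) := by
  rw [Finset.mem_Icc] at hl
  have h0 : ∀ m, (if m + 1 = l then (1 : ℝ) else 0) * f m
      = if m = l - 1 then (if l = 0 then 0 else f m) else 0 := by
    intro m
    by_cases h : m + 1 = l
    · rw [if_pos h, if_pos (by omega), if_neg (by omega), one_mul]
    · rw [if_neg h, zero_mul]; split_ifs <;> first | rfl | omega
  simp only [diffCoeff, sub_mul, Finset.sum_sub_distrib, h0, ite_mul, one_mul, zero_mul,
    Finset.sum_ite_eq', Finset.mem_Icc]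
  rw [if_pos hl, if_neg (by omega : l ≠ 0)]
  by_cases h : l = 1
  · subst h; simp
  · rw [if_pos (by omega), if_neg h]

/-- The covariance of the hierarchical differences of levels `l` and `l'` of the piecewise
constant approximations with nodes `b`. -/
def diffCov (k : ℝ → ℝ → ℝ) (b : ℕ → ℝ) (L l l' : ℕ) : ℝ :=
  ∑ m ∈ Finset.Icc 1 L, ∑ m' ∈ Finset.Icc 1 L,
    diffCoeff l m * diffCoeff l' m' * k (b m) (b m')

/-- The difference in the first variable is estimated by the Lipschitz bound, as consecutive nodes
are within `2^{-l} + 2^{-(l-1)} = 3 * 2^{-l}`; for `l = 1` the sup bound is enough. The difference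
in the second variable gives no cancellation, only the factor `2` from its coefficients. -/
lemma abs_diffCov_le_left {C : ℝ} {k : ℝ → ℝ → ℝ} (hC : 0 ≤ C) (hk : IsLipschitzKernel C k)
    {L : ℕ} {b : ℕ → ℝ} {t : ℝ} (hb : ∀ l ∈ Finset.Icc 1 L, b l ∈ Ioo (0 : ℝ) 1)
    (hbt : ∀ l ∈ Finset.Icc 1 L, |b l - t| ≤ (1 / 2) ^ l) {l l' : ℕ} (hl : l ∈ Finset.Icc 1 L) :
    |diffCov k b L l l'| ≤ 6 * C * (1 / 2) ^ l := by
  have hinner : ∀ m' ∈ Finset.Icc 1 L,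
      |∑ m ∈ Finset.Icc 1 L, diffCoeff l m * k (b m) (b m')| ≤ 3 * C * (1 / 2) ^ l := by
    intro m' hm'
    rw [sum_diffCoeff_mul hl fun m => k (b m) (b m')]
    by_cases h : l = 1
    · subst h
      rw [if_pos rfl]
      have := hk.bdd _ (hb 1 hl) _ (hb m' hm')
      norm_num
      linarith
    · rw [if_neg h]
      have hl' : l - 1 ∈ Finset.Icc 1 L := by rw [Finset.mem_Icc] at hl ⊢; omega
      refine (hk.lipschitz _ (hb l hl) _ (hb _ hl') _ (hb m' hm')).trans ?_
      have h1 := hbt l hl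
      have h2 := hbt _ hl'
      have h3 : ((1 : ℝ) / 2) ^ (l - 1) = 2 * (1 / 2) ^ l := by
        have : l = l - 1 + 1 := by rw [Finset.mem_Icc] at hl; omega
        conv_rhs => rw [this, pow_succ]
        ring
      have h4 : |b l - b (l - 1)| ≤ 3 * (1 / 2) ^ l := by
        have := abs_sub_le (b l) t (b (l - 1))
        rw [abs_sub_comm t] at this
        linarith
      nlinarith
  have hsplit : diffCov k b L l l' = ∑ m' ∈ Finset.Icc 1 L, diffCoeff l' m' *
      ∑ m ∈ Finset.Icc 1 L, diffCoeff l m * k (b m) (b m') := by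
    rw [diffCov, Finset.sum_comm]
    refine Finset.sum_congr rfl fun m' _ => ?_
    rw [Finset.mul_sum]
    exact Finset.sum_congr rfl fun m _ => by ring
  rw [hsplit]
  calc _ ≤ ∑ m' ∈ Finset.Icc 1 L, |diffCoeff l' m'| * (3 * C * (1 / 2) ^ l) := by
        refine (Finset.abs_sum_le_sum_abs _ _).trans (Finset.sum_le_sum fun m' hm' => ?_)
        rw [abs_mul]
        gcongr
        exact hinner m' hm'
    _ ≤ 2 * (3 * C * (1 / 2) ^ l) := by
        rw [← Finset.sum_mul]
        gcongr
        exact sum_abs_diffCoeff_le L l'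
    _ = _ := by ring

lemma diffCov_comm {C : ℝ} {k : ℝ → ℝ → ℝ} (hk : IsLipschitzKernel C k) (b : ℕ → ℝ)
    (L l l' : ℕ) : diffCov k b L l l' = diffCov k b L l' l := by
  rw [diffCov, Finset.sum_comm, diffCov]
  refine Finset.sum_congr rfl fun m _ => Finset.sum_congr rfl fun m' _ => ?_
  rw [hk.symm]; ring

lemma abs_diffCov_le {C : ℝ} {k : ℝ → ℝ → ℝ} (hC : 0 ≤ C) (hk : IsLipschitzKernel C k)
    {L : ℕ} {b : ℕ → ℝ} {t : ℝ} (hb : ∀ l ∈ Finset.Icc 1 L, b l ∈ Ioo (0 : ℝ) 1)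
    (hbt : ∀ l ∈ Finset.Icc 1 L, |b l - t| ≤ (1 / 2) ^ l) {l l' : ℕ} (hl : l ∈ Finset.Icc 1 L)
    (hl' : l' ∈ Finset.Icc 1 L) :
    |diffCov k b L l l'| ≤ 6 * C * min ((1 / 2) ^ l) ((1 / 2) ^ l') := by
  rw [mul_min_of_nonneg _ _ (by positivity)]
  refine le_min (abs_diffCov_le_left hC hk hb hbt hl) ?_
  rw [diffCov_comm hk]
  exact abs_diffCov_le_left hC hk hb hbt hl'

/-- The coefficient of the approximation of multi-level `m` in the sum over the multi-levels
in `T` of the tensor products of hierarchical differences. -/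
def smolyakCoeff {d : ℕ} (T : Finset (Fin d → ℕ)) (m : Fin d → ℕ) : ℝ :=
  ∑ l ∈ T, ∏ j, diffCoeff (l j) (m j)

lemma sum_abs_smolyakCoeff_le {d : ℕ} (T : Finset (Fin d → ℕ)) (L : ℕ) :
    ∑ m ∈ Fintype.piFinset fun _ : Fin d => Finset.Icc 1 L, |smolyakCoeff T m|
      ≤ T.card * 2 ^ d := by
  calc _ ≤ ∑ m ∈ Fintype.piFinset fun _ : Fin d => Finset.Icc 1 L,
        ∑ l ∈ T, ∏ j, |diffCoeff (l j) (m j)| := by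
        refine Finset.sum_le_sum fun m _ => (Finset.abs_sum_le_sum_abs _ _).trans_eq ?_
        simp only [Finset.abs_prod]
    _ = ∑ l ∈ T, ∏ j, ∑ m ∈ Finset.Icc 1 L, |diffCoeff (l j) m| := by
        rw [Finset.sum_comm]
        exact Finset.sum_congr rfl fun l _ => by rw [Finset.prod_univ_sum]
    _ ≤ ∑ l ∈ T, 2 ^ d := by
        refine Finset.sum_le_sum fun l _ => ?_
        refine (Finset.prod_le_prod (fun _ _ => by positivity)
          fun j _ => sum_abs_diffCoeff_le L (l j)).trans_eq ?_
        simp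
    _ = _ := by simp

/-- For a set of levels that is closed downwards, such as that of a sparse grid, this keeps every
evaluation inside the set. -/
lemma smolyakCoeff_ne_zero {d : ℕ} {T : Finset (Fin d → ℕ)} {m : Fin d → ℕ}
    (h : smolyakCoeff T m ≠ 0) : ∃ l ∈ T, m ≤ l := by
  obtain ⟨l, hl, h'⟩ := Finset.exists_ne_zero_of_sum_ne_zero h
  refine ⟨l, hl, fun j => ?_⟩
  by_contra hj
  exact h' (Finset.prod_eq_zero (Finset.mem_univ j) (diffCoeff_eq_zero (not_le.1 hj)))

lemma smolyakCoeff_piFinset {d L : ℕ} {m : Fin d → ℕ}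
    (hm : m ∈ Fintype.piFinset fun _ : Fin d => Finset.Icc 1 L) :
    smolyakCoeff (Fintype.piFinset fun _ : Fin d => Finset.Icc 1 L) m
      = if m = fun _ => L then 1 else 0 := by
  rw [smolyakCoeff, ← Finset.prod_univ_sum (fun _ => Finset.Icc 1 L)
    (fun j l => diffCoeff l (m j)),
    Finset.prod_congr rfl fun j _ => sum_diffCoeff_left (Fintype.mem_piFinset.1 hm j)]
  by_cases h : m = fun _ => L
  · simp [h]
  · obtain ⟨j, hj⟩ := Function.ne_iff.1 h
    rw [if_neg h]
    exact Finset.prod_eq_zero (Finset.mem_univ j) (if_neg hj)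

/-- The Smolyak combination over `T` reproduces the value at the finest multi-level up to the
combination over the complement of `T`. -/
lemma sub_sum_smolyakCoeff {d L : ℕ} {T : Finset (Fin d → ℕ)}
    (hT : T ⊆ Fintype.piFinset fun _ : Fin d => Finset.Icc 1 L) (hL : 1 ≤ L)
    (F : (Fin d → ℕ) → ℝ) :
    F (fun _ => L) - ∑ m ∈ Fintype.piFinset fun _ : Fin d => Finset.Icc 1 L, smolyakCoeff T m * F m
      = ∑ m ∈ Fintype.piFinset fun _ : Fin d => Finset.Icc 1 L,
          smolyakCoeff ((Fintype.piFinset fun _ : Fin d => Finset.Icc 1 L) \ T) m * F m := by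
  have h1 : F (fun _ => L) = ∑ m ∈ Fintype.piFinset fun _ : Fin d => Finset.Icc 1 L,
      smolyakCoeff (Fintype.piFinset fun _ : Fin d => Finset.Icc 1 L) m * F m := by
    rw [Finset.sum_congr rfl fun m hm => by rw [smolyakCoeff_piFinset hm]]
    simp only [ite_mul, one_mul, zero_mul, Finset.sum_ite_eq']
    rw [if_pos]
    simp [hL]
  rw [h1, ← Finset.sum_sub_distrib]
  refine Finset.sum_congr rfl fun m _ => ?_
  rw [← sub_mul]
  congr 1
  simp only [smolyakCoeff]
  rw [← Finset.sum_sdiff hT]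
  ring

/-- The left side is the variance of a Smolyak combination. Coefficients and kernel are products
over coordinates, so the sums over levels factor. -/
lemma sum_smolyakCoeff_kernel {d L : ℕ} (T : Finset (Fin d → ℕ)) (p q : Fin d → ℝ → ℝ)
    (b : Fin d → ℕ → ℝ) :
    ∑ m ∈ Fintype.piFinset fun _ : Fin d => Finset.Icc 1 L,
      ∑ m' ∈ Fintype.piFinset fun _ : Fin d => Finset.Icc 1 L,
        smolyakCoeff T m * smolyakCoeff T m'
          * tmKernel p q (fun j => b j (m j)) (fun j => b j (m' j))
      = ∑ l ∈ T, ∑ l' ∈ T, ∏ j, diffCov (markovKernel (p j) (q j)) (b j) L (l j) (l' j) := by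
  set N := Fintype.piFinset fun _ : Fin d => Finset.Icc 1 L with hN
  have hrhs : ∀ l l' : Fin d → ℕ, ∏ j, diffCov (markovKernel (p j) (q j)) (b j) L (l j) (l' j)
      = ∑ m ∈ N, ∑ m' ∈ N, (∏ j, diffCoeff (l j) (m j)) * (∏ j, diffCoeff (l' j) (m' j))
          * tmKernel p q (fun j => b j (m j)) (fun j => b j (m' j)) := by
    intro l l'
    simp only [diffCov, Finset.prod_univ_sum, ← hN, Finset.prod_mul_distrib, tmKernel_eq_prod]
  simp only [hrhs]
  have hlhs : ∀ m m' : Fin d → ℕ, smolyakCoeff T m * smolyakCoeff T m'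
          * tmKernel p q (fun j => b j (m j)) (fun j => b j (m' j))
      = ∑ l ∈ T, ∑ l' ∈ T, (∏ j, diffCoeff (l j) (m j)) * (∏ j, diffCoeff (l' j) (m' j))
          * tmKernel p q (fun j => b j (m j)) (fun j => b j (m' j)) := by
    intro m m'
    rw [smolyakCoeff, smolyakCoeff, Finset.sum_mul_sum, Finset.sum_mul]
    exact Finset.sum_congr rfl fun l _ => by rw [Finset.sum_mul]
  simp only [hlhs]
  calc _ = ∑ m ∈ N, ∑ l ∈ T, ∑ l' ∈ T, ∑ m' ∈ N, (∏ j, diffCoeff (l j) (m j))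
          * (∏ j, diffCoeff (l' j) (m' j))
          * tmKernel p q (fun j => b j (m j)) (fun j => b j (m' j)) := by
        refine Finset.sum_congr rfl fun m _ => ?_
        rw [Finset.sum_comm]
        exact Finset.sum_congr rfl fun l _ => Finset.sum_comm
    _ = _ := by
        rw [Finset.sum_comm]
        exact Finset.sum_congr rfl fun l _ => Finset.sum_comm

lemma sum_smolyakCoeff_kernel_le {d L : ℕ} {T : Finset (Fin d → ℕ)}
    (hT : T ⊆ Fintype.piFinset fun _ : Fin d => Finset.Icc 1 L) {p q : Fin d → ℝ → ℝ}
    {C : ℝ} (hC : 0 ≤ C) (hk : ∀ j, IsLipschitzKernel C (markovKernel (p j) (q j)))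
    {b : Fin d → ℕ → ℝ} {z : Fin d → ℝ}
    (hb : ∀ j, ∀ l ∈ Finset.Icc 1 L, b j l ∈ Ioo (0 : ℝ) 1)
    (hbz : ∀ j, ∀ l ∈ Finset.Icc 1 L, |b j l - z j| ≤ (1 / 2) ^ l) :
    ∑ m ∈ Fintype.piFinset fun _ : Fin d => Finset.Icc 1 L,
      ∑ m' ∈ Fintype.piFinset fun _ : Fin d => Finset.Icc 1 L,
        smolyakCoeff T m * smolyakCoeff T m'
          * tmKernel p q (fun j => b j (m j)) (fun j => b j (m' j))
      ≤ (6 * C) ^ d * (8 ^ d * ∑ l ∈ T, (1 / 2 : ℝ) ^ (∑ j, l j)) := by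
  rw [sum_smolyakCoeff_kernel]
  calc _ ≤ ∑ l ∈ T, ∑ l' ∈ T,
        (6 * C) ^ d * ∏ j, min ((1 / 2 : ℝ) ^ l j) ((1 / 2) ^ l' j) := by
        refine Finset.sum_le_sum fun l hl => Finset.sum_le_sum fun l' hl' => ?_
        refine (le_abs_self _).trans ?_
        rw [Finset.abs_prod]
        refine (Finset.prod_le_prod (fun _ _ => abs_nonneg _) fun j _ =>
          abs_diffCov_le hC (hk j) (hb j) (hbz j) (Fintype.mem_piFinset.1 (hT hl) j)
            (Fintype.mem_piFinset.1 (hT hl') j)).trans_eq ?_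
        rw [Finset.prod_mul_distrib]
        simp
    _ = (6 * C) ^ d * ∑ l ∈ T, ∑ l' ∈ T, ∏ j, min ((1 / 2 : ℝ) ^ l j) ((1 / 2) ^ l' j) := by
        simp only [Finset.mul_sum]
    _ ≤ _ := by
        gcongr
        exact sum_prod_min_half_pow_le T hT

/-! ### Optimality of the kriging weights -/

/-- The quadratic risk `wᵀ M w - 2 wᵀ κ + c` of the weights `w`. -/
noncomputable def quadraticRisk {n : ℕ} (M : Matrix (Fin n) (Fin n) ℝ) (κ : Fin n → ℝ)
    (c : ℝ) (w : Fin n → ℝ) : ℝ := w ⬝ᵥ M.mulVec w - 2 * (w ⬝ᵥ κ) + c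

/-- Completing the square: with `M v = κ`, the risk of `w` exceeds that of `v` by `(w - v)ᵀ M (w -
v) ≥ 0`. -/
lemma quadraticRisk_le {n : ℕ} {M : Matrix (Fin n) (Fin n) ℝ} (hM : M.PosDef) (κ : Fin n → ℝ)
    (c : ℝ) (w : Fin n → ℝ) :
    quadraticRisk M κ c (Matrix.vecMul κ M⁻¹) ≤ quadraticRisk M κ c w := by
  set v := Matrix.vecMul κ M⁻¹ with hv
  have hdet : IsUnit M.det := hM.det_pos.ne'.isUnit
  have hsymm : M.transpose = M := by simpa using hM.isHermitian.eq
  have hvM : Matrix.vecMul v M = κ := by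
    rw [hv, Matrix.vecMul_vecMul, Matrix.nonsing_inv_mul _ hdet, Matrix.vecMul_one]
  have hMv : M.mulVec v = κ := by rw [← hsymm, Matrix.mulVec_transpose, hvM]
  have hpos : 0 ≤ (w - v) ⬝ᵥ M.mulVec (w - v) := by
    simpa using hM.posSemidef.dotProduct_mulVec_nonneg (w - v)
  have hvMw : v ⬝ᵥ M.mulVec w = κ ⬝ᵥ w := by rw [Matrix.dotProduct_mulVec, hvM]
  rw [Matrix.mulVec_sub, dotProduct_sub, sub_dotProduct, sub_dotProduct, hvMw, hMv,
    dotProduct_comm κ w] at hpos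
  rw [quadraticRisk, quadraticRisk, hMv]
  linarith

/-- The error `∑ i, w i * Y (x i) - Y z` of the linear predictor with weights `w` in the
absence of noise. -/
noncomputable def linearError {Ω : Type*} {d n : ℕ} (x : Fin n → Fin d → ℝ)
    (Y : (Fin d → ℝ) → Ω → ℝ) (w : Fin n → ℝ) (z : Fin d → ℝ) (ω : Ω) : ℝ :=
  ∑ i, w i * Y (x i) ω - Y z ω

/-- The contribution of the noise to the linear predictor with weights `w`. -/
noncomputable def linearNoise {Ω : Type*} {n : ℕ} (m : Fin n → ℕ) (ε : Fin n → ℕ → Ω → ℝ)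
    (w : Fin n → ℝ) (ω : Ω) : ℝ :=
  ∑ a : (i : Fin n) × Fin (m i), w a.1 * (m a.1 : ℝ)⁻¹ * ε a.1 a.2 ω

lemma dotProduct_sampleMean_sub {Ω : Type*} {d n : ℕ} {x : Fin n → Fin d → ℝ} {m : Fin n → ℕ}
    (hm : ∀ i, 1 ≤ m i) (Y : (Fin d → ℝ) → Ω → ℝ) (ε : Fin n → ℕ → Ω → ℝ) (w : Fin n → ℝ)
    (z : Fin d → ℝ) (ω : Ω) :
    w ⬝ᵥ sampleMean x m Y ε ω - Y z ω = linearError x Y w z ω + linearNoise m ε w ω := by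
  have h : w ⬝ᵥ sampleMean x m Y ε ω = ∑ i, w i * Y (x i) ω + linearNoise m ε w ω := by
    rw [linearNoise, Fintype.sum_sigma, ← Finset.sum_add_distrib]
    refine Finset.sum_congr rfl fun i _ => ?_
    have hmi : (m i : ℝ) ≠ 0 := Nat.cast_ne_zero.2 (by have := hm i; omega)
    rw [sampleMean, Finset.sum_add_distrib, Finset.sum_range (fun r => ε i r ω)]
    simp only [Finset.sum_const, Finset.card_range, nsmul_eq_mul]
    rw [← Finset.mul_sum]
    field_simp
  rw [h, linearError]
  ring

lemma skPredictor_eq_dotProduct {Ω : Type*} {d n : ℕ} {k : (Fin d → ℝ) → (Fin d → ℝ) → ℝ}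
    {σ : (Fin d → ℝ) → ℝ} {x : Fin n → Fin d → ℝ} {m : Fin n → ℕ} {Y : (Fin d → ℝ) → Ω → ℝ}
    {ε : Fin n → ℕ → Ω → ℝ} (z : Fin d → ℝ) (ω : Ω) :
    skPredictor k σ x m Y ε z ω
      = Matrix.vecMul (fun i => k z (x i)) (kernelMatrix k x + noiseMatrix σ x m)⁻¹
        ⬝ᵥ sampleMean x m Y ε ω := by
  rw [skPredictor, Matrix.dotProduct_mulVec]

lemma posSemidef_noiseMatrix {d n : ℕ} {σ : (Fin d → ℝ) → ℝ} {x : Fin n → Fin d → ℝ}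
    {m : Fin n → ℕ} : (noiseMatrix σ x m).PosSemidef :=
  Matrix.PosSemidef.diagonal fun i => by positivity

variable {Ω : Type*} [MeasurableSpace Ω] {P : Measure Ω} {d n : ℕ}

/-! ### Second moments -/

lemma IsCenteredGP.memLp {S : Set (Fin d → ℝ)} {k : (Fin d → ℝ) → (Fin d → ℝ) → ℝ}
    {Y : (Fin d → ℝ) → Ω → ℝ} (hY : IsCenteredGP S k Y P) {z : Fin d → ℝ} (hz : z ∈ S) :
    MemLp (Y z) 2 P :=
  (hY.gaussian.hasGaussianLaw_eval ⟨z, hz⟩).memLp_two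

lemma IsCenteredGP.integral_mul {S : Set (Fin d → ℝ)} [IsProbabilityMeasure P]
    {k : (Fin d → ℝ) → (Fin d → ℝ) → ℝ}
    {Y : (Fin d → ℝ) → Ω → ℝ} (hY : IsCenteredGP S k Y P) {z z' : Fin d → ℝ} (hz : z ∈ S)
    (hz' : z' ∈ S) : ∫ ω, Y z ω * Y z' ω ∂P = k z z' := by
  rw [← hY.cov_eq z hz z' hz', covariance_eq_sub (hY.memLp hz) (hY.memLp hz'), hY.mean_zero z hz]
  simp

lemma IsCenteredGP.integral_sum_mul_sum {S : Set (Fin d → ℝ)} [IsProbabilityMeasure P]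
    {k : (Fin d → ℝ) → (Fin d → ℝ) → ℝ} {Y : (Fin d → ℝ) → Ω → ℝ} (hY : IsCenteredGP S k Y P)
    {ι κ : Type*} (s : Finset ι) (t : Finset κ) (a : ι → ℝ) (b : κ → ℝ) {u : ι → Fin d → ℝ}
    {v : κ → Fin d → ℝ} (hu : ∀ i ∈ s, u i ∈ S) (hv : ∀ i ∈ t, v i ∈ S) :
    ∫ ω, (∑ i ∈ s, a i * Y (u i) ω) * ∑ j ∈ t, b j * Y (v j) ω ∂P
      = ∑ i ∈ s, ∑ j ∈ t, a i * b j * k (u i) (v j) := by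
  have hint : ∀ i ∈ s, ∀ j ∈ t, Integrable (fun ω => a i * b j * (Y (u i) ω * Y (v j) ω)) P :=
    fun i hi j hj => ((hY.memLp (hu i hi)).integrable_mul (hY.memLp (hv j hj))).const_mul _
  have hexp : ∀ ω, (∑ i ∈ s, a i * Y (u i) ω) * ∑ j ∈ t, b j * Y (v j) ω
      = ∑ i ∈ s, ∑ j ∈ t, a i * b j * (Y (u i) ω * Y (v j) ω) := by
    intro ω
    rw [Finset.sum_mul_sum]
    exact Finset.sum_congr rfl fun i _ => Finset.sum_congr rfl fun j _ => by ring
  simp only [hexp]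
  rw [integral_finsetSum _ fun i hi => integrable_finsetSum _ fun j hj => hint i hi j hj]
  refine Finset.sum_congr rfl fun i hi => ?_
  rw [integral_finsetSum _ fun j hj => hint i hi j hj]
  refine Finset.sum_congr rfl fun j hj => ?_
  rw [integral_const_mul, hY.integral_mul (hu i hi) (hv j hj)]

section Moments

variable {k : (Fin d → ℝ) → (Fin d → ℝ) → ℝ} {Y : (Fin d → ℝ) → Ω → ℝ}
  {σ : (Fin d → ℝ) → ℝ} {x : Fin n → Fin d → ℝ} {m : Fin n → ℕ} {ε : Fin n → ℕ → Ω → ℝ}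

lemma IsCenteredGP.memLp_linearError (hY : IsCenteredGP (unitCube d) k Y P)
    (hx : ∀ i, x i ∈ unitCube d) (w : Fin n → ℝ) {z : Fin d → ℝ} (hz : z ∈ unitCube d) :
    MemLp (linearError x Y w z) 2 P :=
  (memLp_finsetSum _ fun i _ => (hY.memLp (hx i)).const_mul (w i)).sub (hY.memLp hz)

lemma IsSimulationNoise.memLp (hε : IsSimulationNoise σ x m Y ε P) {i : Fin n} {r : ℕ}
    (hr : r < m i) : MemLp (ε i r) 2 P := by
  have h := hε.law i r hr
  have h2 : MemLp id 2 (P.map (ε i r)) := by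
    rw [h.map_eq]
    exact memLp_id_gaussianReal 2
  exact (memLp_map_measure_iff h2.1 h.aemeasurable).1 h2

lemma IsSimulationNoise.integral_eq_zero (hε : IsSimulationNoise σ x m Y ε P) {i : Fin n} {r : ℕ}
    (hr : r < m i) : ∫ ω, ε i r ω ∂P = 0 := by
  rw [(hε.law i r hr).integral_eq, integral_id_gaussianReal]

lemma IsSimulationNoise.variance_eq (hε : IsSimulationNoise σ x m Y ε P) {i : Fin n} {r : ℕ}
    (hr : r < m i) : variance (ε i r) P = σ (x i) ^ 2 := by
  rw [(hε.law i r hr).variance_eq, variance_id_gaussianReal, Real.coe_toNNReal _ (sq_nonneg _)]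

lemma IsSimulationNoise.memLp_linearNoise (hε : IsSimulationNoise σ x m Y ε P) (w : Fin n → ℝ) :
    MemLp (linearNoise m ε w) 2 P :=
  memLp_finsetSum _ fun a _ => (hε.memLp a.2.2).const_mul _

lemma IsSimulationNoise.integral_linearNoise [IsProbabilityMeasure P]
    (hε : IsSimulationNoise σ x m Y ε P)
    (w : Fin n → ℝ) : ∫ ω, linearNoise m ε w ω ∂P = 0 := by
  simp only [linearNoise]
  rw [integral_finsetSum _ fun a _ => ((hε.memLp a.2.2).integrable (by norm_num)).const_mul _]
  refine Finset.sum_eq_zero fun a _ => ?_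
  rw [integral_const_mul, hε.integral_eq_zero a.2.2, mul_zero]

lemma IsSimulationNoise.integral_sq_linearNoise [IsProbabilityMeasure P]
    (hε : IsSimulationNoise σ x m Y ε P)
    (hm : ∀ i, 1 ≤ m i) (w : Fin n → ℝ) :
    ∫ ω, linearNoise m ε w ω ^ 2 ∂P = ∑ i, w i ^ 2 * (σ (x i) ^ 2 / m i) := by
  rw [← variance_of_integral_eq_zero (hε.memLp_linearNoise w).aemeasurable
    (hε.integral_linearNoise w)]
  have hsum : linearNoise m ε w = ∑ a : (i : Fin n) × Fin (m i),
      fun ω => w a.1 * (m a.1 : ℝ)⁻¹ * ε a.1 a.2 ω := by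
    funext ω
    simp [linearNoise]
  rw [hsum, IndepFun.variance_sum (fun a _ => (hε.memLp a.2.2).const_mul _)]
  · rw [Fintype.sum_sigma]
    refine Finset.sum_congr rfl fun i _ => ?_
    have hmi : (m i : ℝ) ≠ 0 := Nat.cast_ne_zero.2 (by have := hm i; omega)
    rw [Finset.sum_congr rfl fun r _ => by
      rw [variance_const_mul, hε.variance_eq (i := i) (r := r) r.2]]
    simp only [Finset.sum_const, Finset.card_univ, Fintype.card_fin, nsmul_eq_mul]
    field_simp
  · intro a _ b _ hab
    exact (hε.indep.indepFun hab).comp (measurable_const_mul (w a.1 * (m a.1 : ℝ)⁻¹))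
      (measurable_const_mul (w b.1 * (m b.1 : ℝ)⁻¹))

lemma IsSimulationNoise.indepFun_linearNoise_linearError (hε : IsSimulationNoise σ x m Y ε P)
    (hx : ∀ i, x i ∈ unitCube d) (w : Fin n → ℝ) {z : Fin d → ℝ} (hz : z ∈ unitCube d) :
    IndepFun (linearNoise m ε w) (linearError x Y w z) P := by
  refine hε.indep_process.comp
    (φ := fun e => ∑ a : (i : Fin n) × Fin (m i), w a.1 * (m a.1 : ℝ)⁻¹ * e a)
    (ψ := fun y => ∑ i, w i * y ⟨x i, hx i⟩ - y ⟨z, hz⟩) ?_ ?_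
  · fun_prop
  · fun_prop

lemma integral_sq_predictor_sub [IsProbabilityMeasure P]
    (hY : IsCenteredGP (unitCube d) k Y P)
    (hε : IsSimulationNoise σ x m Y ε P) (hx : ∀ i, x i ∈ unitCube d) (hm : ∀ i, 1 ≤ m i)
    (w : Fin n → ℝ) {z : Fin d → ℝ} (hz : z ∈ unitCube d) :
    ∫ ω, (w ⬝ᵥ sampleMean x m Y ε ω - Y z ω) ^ 2 ∂P
      = ∫ ω, linearError x Y w z ω ^ 2 ∂P + ∑ i, w i ^ 2 * (σ (x i) ^ 2 / m i) := by
  have hU := hY.memLp_linearError hx w hz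
  have hV := hε.memLp_linearNoise w
  have hUV : ∫ ω, linearNoise m ε w ω * linearError x Y w z ω ∂P = 0 := by
    rw [(hε.indepFun_linearNoise_linearError hx w hz).integral_fun_mul_eq_mul_integral
      hV.aestronglyMeasurable hU.aestronglyMeasurable, hε.integral_linearNoise, zero_mul]
  have hexp : ∀ ω, (w ⬝ᵥ sampleMean x m Y ε ω - Y z ω) ^ 2 = linearError x Y w z ω ^ 2
      + (2 * (linearNoise m ε w ω * linearError x Y w z ω) + linearNoise m ε w ω ^ 2) := by
    intro ω
    rw [dotProduct_sampleMean_sub hm]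
    ring
  have hi : Integrable (fun ω => 2 * (linearNoise m ε w ω * linearError x Y w z ω)) P :=
    (hV.integrable_mul hU).const_mul 2
  have hi' : Integrable (fun ω => 2 * (linearNoise m ε w ω * linearError x Y w z ω)
    + linearNoise m ε w ω ^ 2) P := hi.add hV.integrable_sq
  simp only [hexp]
  rw [integral_add hU.integrable_sq hi', integral_add hi hV.integrable_sq, integral_const_mul,
    ← hε.integral_sq_linearNoise hm w, hUV, mul_zero, zero_add]

lemma integral_sq_linearError [IsProbabilityMeasure P]
    (hY : IsCenteredGP (unitCube d) k Y P)
    (hx : ∀ i, x i ∈ unitCube d) (w : Fin n → ℝ) (hk : ∀ z z', k z z' = k z' z)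
    {z : Fin d → ℝ} (hz : z ∈ unitCube d) :
    ∫ ω, linearError x Y w z ω ^ 2 ∂P
      = quadraticRisk (kernelMatrix k x) (fun i => k z (x i)) (k z z) w := by
  have hS : MemLp (fun ω => ∑ i, w i * Y (x i) ω) 2 P :=
    memLp_finsetSum _ fun i _ => (hY.memLp (hx i)).const_mul (w i)
  have h1 := hY.integral_sum_mul_sum Finset.univ Finset.univ w w (fun i _ => hx i) (fun i _ => hx i)
  -- A one-point index set presents `Y z` as a sum.
  have h2 := hY.integral_sum_mul_sum Finset.univ ({()} : Finset Unit) w (fun _ => 1)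
    (v := fun _ => z) (fun i _ => hx i) (fun i _ => hz)
  simp only [Finset.sum_singleton, one_mul, mul_one] at h2
  have h3 := hY.integral_mul hz hz
  have hexp : ∀ ω, linearError x Y w z ω ^ 2
      = (∑ i, w i * Y (x i) ω) * (∑ i, w i * Y (x i) ω)
        + (-2 * ((∑ i, w i * Y (x i) ω) * Y z ω) + Y z ω * Y z ω) := by
    intro ω
    rw [linearError]
    ring
  have i1 : Integrable (fun ω => (∑ i, w i * Y (x i) ω) * (∑ i, w i * Y (x i) ω)) P :=
    hS.integrable_mul hS
  have i2 : Integrable (fun ω => -2 * ((∑ i, w i * Y (x i) ω) * Y z ω)) P :=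
    (hS.integrable_mul (hY.memLp hz)).const_mul (-2)
  have i3 : Integrable (fun ω => Y z ω * Y z ω) P := (hY.memLp hz).integrable_mul (hY.memLp hz)
  have i23 : Integrable (fun ω => -2 * ((∑ i, w i * Y (x i) ω) * Y z ω) + Y z ω * Y z ω) P :=
    i2.add i3
  simp only [hexp]
  rw [integral_add i1 i23, integral_add i2 i3, integral_const_mul, h1, h2, h3,
    quadraticRisk]
  simp only [dotProduct, Matrix.mulVec, kernelMatrix, Matrix.of_apply, Finset.mul_sum, hk z]
  have : ∀ i j, w i * (k (x i) (x j) * w j) = w i * w j * k (x i) (x j) := fun i j => by ring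
  simp only [this]
  rw [← Finset.mul_sum, ← Finset.mul_sum]
  ring

/-- The mean squared error of the linear predictor with weights `w`. -/
lemma integral_sq_predictor_sub_eq_quadraticRisk [IsProbabilityMeasure P]
    (hY : IsCenteredGP (unitCube d) k Y P)
    (hε : IsSimulationNoise σ x m Y ε P) (hx : ∀ i, x i ∈ unitCube d) (hm : ∀ i, 1 ≤ m i)
    (hk : ∀ z z', k z z' = k z' z) (w : Fin n → ℝ) {z : Fin d → ℝ} (hz : z ∈ unitCube d) :
    ∫ ω, (w ⬝ᵥ sampleMean x m Y ε ω - Y z ω) ^ 2 ∂P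
      = quadraticRisk (kernelMatrix k x + noiseMatrix σ x m) (fun i => k z (x i)) (k z z) w := by
  rw [integral_sq_predictor_sub hY hε hx hm w hz, integral_sq_linearError hY hx w hk hz,
    quadraticRisk, quadraticRisk, Matrix.add_mulVec, dotProduct_add]
  have : w ⬝ᵥ (noiseMatrix σ x m).mulVec w = ∑ i, w i ^ 2 * (σ (x i) ^ 2 / m i) := by
    simp only [noiseMatrix, dotProduct, Matrix.mulVec_diagonal]
    exact Finset.sum_congr rfl fun i _ => by ring
  rw [this]
  ring

/-- The stochastic kriging predictor is the best linear predictor. -/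
lemma integral_sq_skPredictor_le [IsProbabilityMeasure P]
    (hY : IsCenteredGP (unitCube d) k Y P)
    (hε : IsSimulationNoise σ x m Y ε P) (hx : ∀ i, x i ∈ unitCube d) (hm : ∀ i, 1 ≤ m i)
    (hk : ∀ z z', k z z' = k z' z) (hK : (kernelMatrix k x).PosDef) (w : Fin n → ℝ)
    {z : Fin d → ℝ} (hz : z ∈ unitCube d) :
    ∫ ω, (skPredictor k σ x m Y ε z ω - Y z ω) ^ 2 ∂P
      ≤ ∫ ω, linearError x Y w z ω ^ 2 ∂P + ∑ i, w i ^ 2 * (σ (x i) ^ 2 / m i) := by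
  simp only [skPredictor_eq_dotProduct]
  rw [← integral_sq_predictor_sub hY hε hx hm w hz,
    integral_sq_predictor_sub_eq_quadraticRisk hY hε hx hm hk _ hz,
    integral_sq_predictor_sub_eq_quadraticRisk hY hε hx hm hk _ hz]
  exact quadraticRisk_le (hK.add_posSemidef posSemidef_noiseMatrix) _ _ _

lemma integrable_sq_skPredictor_sub (hY : IsCenteredGP (unitCube d) k Y P)
    (hε : IsSimulationNoise σ x m Y ε P) (hx : ∀ i, x i ∈ unitCube d) (hm : ∀ i, 1 ≤ m i)
    {z : Fin d → ℝ} (hz : z ∈ unitCube d) :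
    Integrable (fun ω => (skPredictor k σ x m Y ε z ω - Y z ω) ^ 2) P := by
  simp only [skPredictor_eq_dotProduct, dotProduct_sampleMean_sub hm]
  exact ((hY.memLp_linearError hx _ hz).add (hε.memLp_linearNoise _)).integrable_sq

/-- The mean squared error of stochastic kriging is at most the variance of the process. -/
lemma integral_sq_skPredictor_le_kernel [IsProbabilityMeasure P]
    (hY : IsCenteredGP (unitCube d) k Y P)
    (hε : IsSimulationNoise σ x m Y ε P) (hx : ∀ i, x i ∈ unitCube d) (hm : ∀ i, 1 ≤ m i)
    (hk : ∀ z z', k z z' = k z' z) (hK : (kernelMatrix k x).PosDef)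
    {z : Fin d → ℝ} (hz : z ∈ unitCube d) :
    ∫ ω, (skPredictor k σ x m Y ε z ω - Y z ω) ^ 2 ∂P ≤ k z z := by
  -- Comparison with the zero predictor, whose error is `-Y z`.
  refine (integral_sq_skPredictor_le hY hε hx hm hk hK 0 hz).trans_eq ?_
  rw [integral_sq_linearError hY hx 0 hk hz]
  simp [quadraticRisk]

end Moments

/-! ### The sparse grid predictor -/

lemma mem_sparseLevels {d τ : ℕ} {l : Fin d → ℕ} :
    l ∈ sparseLevels d τ ↔ (∀ j, 1 ≤ l j) ∧ ∑ j, l j ≤ τ + d - 1 := by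
  rw [sparseLevels, Finset.mem_filter, Fintype.mem_piFinset]
  simp only [Finset.mem_Icc]
  refine ⟨fun h => ⟨fun j => (h.1 j).1, h.2⟩, fun h => ⟨fun j => ⟨h.1 j, ?_⟩, h.2⟩⟩
  exact (Finset.single_le_sum (f := l) (fun _ _ => Nat.zero_le _) (Finset.mem_univ j)).trans h.2

lemma le_of_mem_sparseLevels {e τ : ℕ} {l : Fin (e + 1) → ℕ} (hl : l ∈ sparseLevels (e + 1) τ)
    (j : Fin (e + 1)) : l j ≤ τ := by
  obtain ⟨h1, h2⟩ := mem_sparseLevels.1 hl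
  have h3 : ∑ i : Fin e, 1 ≤ ∑ i : Fin e, l (j.succAbove i) :=
    Finset.sum_le_sum fun i _ => h1 _
  rw [Fin.sum_univ_succAbove l j] at h2
  simp only [Finset.sum_const, Finset.card_univ, Fintype.card_fin, smul_eq_mul, mul_one] at h3
  omega

lemma card_sparseLevels_le (e τ : ℕ) : (sparseLevels (e + 1) τ).card ≤ (τ + e) ^ (e + 1) := by
  refine (Finset.card_filter_le _ _).trans_eq ?_
  simp [Fintype.card_piFinset]

/-- A combination of point evaluations at points of an injective family is a combination of
the evaluations at the members of the family, with no larger total mass. -/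
lemma exists_weights_of_injective {E ι : Type*} {n : ℕ} {x : Fin n → E}
    (hx : Function.Injective x) (s : Finset ι) (y : ι → E) (c : ι → ℝ)
    (hy : ∀ m ∈ s, c m ≠ 0 → ∃ i, x i = y m) :
    ∃ w : Fin n → ℝ, (∀ F : E → ℝ, ∑ i, w i * F (x i) = ∑ m ∈ s, c m * F (y m)) ∧
      ∑ i, |w i| ≤ ∑ m ∈ s, |c m| := by
  classical
  -- Stated for general `G` so that `G u a = a * F u` gives the values and `G u a = |a|` the total
  -- mass.
  have key : ∀ m ∈ s, ∀ G : E → ℝ → ℝ, (∀ u, G u 0 = 0) →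
      ∑ i, G (x i) (if x i = y m then c m else 0) = G (y m) (c m) := by
    intro m hm G hG
    by_cases h : c m = 0
    · simp [h, hG]
    · obtain ⟨i, hi⟩ := hy m hm h
      rw [Finset.sum_eq_single i]
      · rw [if_pos hi, hi]
      · intro b _ hb
        rw [if_neg, hG]
        intro h'
        exact hb (hx (h'.trans hi.symm))
      · simp
  refine ⟨fun i => ∑ m ∈ s, if x i = y m then c m else 0, fun F => ?_, ?_⟩
  · simp only [Finset.sum_mul]
    rw [Finset.sum_comm]
    exact Finset.sum_congr rfl fun m hm => key m hm (fun u a => a * F u) (by simp)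
  · calc _ ≤ ∑ i, ∑ m ∈ s, |if x i = y m then c m else 0| :=
          Finset.sum_le_sum fun i _ => Finset.abs_sum_le_sum_abs _ _
      _ = ∑ m ∈ s, |c m| := by
          rw [Finset.sum_comm]
          exact Finset.sum_congr rfl fun m hm => key m hm (fun _ a => |a|) (by simp)

/-- The artificial top level `τ + 1` is `z` itself, so the approximation error becomes a finite sum
of differences. -/
lemma exists_nodes {d : ℕ} (τ : ℕ) {z : Fin d → ℝ} (hz : z ∈ unitCube d) :
    ∃ b : Fin d → ℕ → ℝ, (∀ j, b j (τ + 1) = z j) ∧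
      (∀ j, ∀ l ∈ Finset.Icc 1 τ, b j l ∈ dyadicGrid l) ∧
      (∀ j, ∀ l ∈ Finset.Icc 1 (τ + 1), b j l ∈ Ioo (0 : ℝ) 1) ∧
      ∀ j, ∀ l ∈ Finset.Icc 1 (τ + 1), |b j l - z j| ≤ (1 / 2) ^ l := by
  have h : ∀ j l, ∃ a : ℝ, 1 ≤ l → a ∈ dyadicGrid l ∧ |a - z j| ≤ (1 / 2) ^ l := by
    intro j l
    by_cases hl : 1 ≤ l
    · obtain ⟨a, ha, ha'⟩ := exists_mem_dyadicGrid hl (hz j)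
      exact ⟨a, fun _ => ⟨ha, ha'⟩⟩
    · exact ⟨0, fun h => absurd h hl⟩
  choose a ha using h
  refine ⟨fun j l => if l = τ + 1 then z j else a j l, fun j => if_pos rfl, fun j l hl => ?_,
    fun j l hl => ?_, fun j l hl => ?_⟩ <;> rw [Finset.mem_Icc] at hl <;> dsimp only
  · rw [if_neg (by omega)]
    exact (ha j l hl.1).1
  · split_ifs
    · exact hz j
    · exact mem_Ioo_of_mem_dyadicGrid (ha j l hl.1).1
  · split_ifs
    · simp
    · exact (ha j l hl.1).2

/-- If the design contains a classical sparse grid then some linear predictor has weights of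
small total mass and a small mean squared error in the absence of noise. -/
lemma exists_weights_integral_sq_linearError_le {Ω : Type*} [MeasurableSpace Ω] {P : Measure Ω}
    [IsProbabilityMeasure P] {e n τ : ℕ} {p q : Fin (e + 1) → ℝ → ℝ} {C : ℝ} (hC : 0 ≤ C)
    (hk : ∀ j, IsLipschitzKernel C (markovKernel (p j) (q j)))
    {Y : (Fin (e + 1) → ℝ) → Ω → ℝ} (hY : IsCenteredGP (unitCube (e + 1)) (tmKernel p q) Y P)
    {x : Fin n → Fin (e + 1) → ℝ} (hx : Function.Injective x)
    (hgrid : ∀ y ∈ sparseGrid (e + 1) τ, ∃ i, x i = y)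
    {z : Fin (e + 1) → ℝ} (hz : z ∈ unitCube (e + 1)) :
    ∃ w : Fin n → ℝ, ∑ i, |w i| ≤ ((τ + e : ℕ) : ℝ) ^ (e + 1) * 2 ^ (e + 1) ∧
      ∫ ω, linearError x Y w z ω ^ 2 ∂P ≤ (6 * C) ^ (e + 1) * (8 ^ (e + 1) *
        (((τ + 1 : ℕ) : ℝ) ^ e * (2 * (1 / 2) ^ (τ + e + 1)))) := by
  classical
  obtain ⟨b, hbz, hbg, hbI, hbn⟩ := exists_nodes τ hz
  set N : Finset (Fin (e + 1) → ℕ) := Fintype.piFinset fun _ => Finset.Icc 1 (τ + 1) with hN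
  set T := sparseLevels (e + 1) τ with hT
  have hTN : T ⊆ N := fun l hl => Fintype.mem_piFinset.2 fun j => Finset.mem_Icc.2
    ⟨(mem_sparseLevels.1 hl).1 j, (le_of_mem_sparseLevels hl j).trans (Nat.le_succ τ)⟩
  set y : (Fin (e + 1) → ℕ) → Fin (e + 1) → ℝ := fun m j => b j (m j) with hy
  have hyI : ∀ m ∈ N, y m ∈ unitCube (e + 1) := fun m hm j =>
    hbI j _ (Fintype.mem_piFinset.1 hm j)
  have hyT : ∀ m ∈ N, smolyakCoeff T m ≠ 0 → ∃ i, x i = y m := by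
    intro m hm hne
    obtain ⟨l, hl, hml⟩ := smolyakCoeff_ne_zero hne
    have hm1 : ∀ j, 1 ≤ m j := fun j => (Finset.mem_Icc.1 (Fintype.mem_piFinset.1 hm j)).1
    have hmT : m ∈ T := mem_sparseLevels.2
      ⟨hm1, (Finset.sum_le_sum fun j _ => hml j).trans (mem_sparseLevels.1 hl).2⟩
    refine hgrid _ (Finset.mem_biUnion.2 ⟨m, hmT, Fintype.mem_piFinset.2 fun j => ?_⟩)
    exact hbg j _ (Finset.mem_Icc.2 ⟨hm1 j, le_of_mem_sparseLevels hmT j⟩)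
  obtain ⟨w, hw, hw1⟩ := exists_weights_of_injective hx N y (smolyakCoeff T) hyT
  refine ⟨w, ?_, ?_⟩
  · refine hw1.trans ((sum_abs_smolyakCoeff_le T (τ + 1)).trans ?_)
    gcongr
    exact_mod_cast card_sparseLevels_le e τ
  · have herr : ∀ ω, linearError x Y w z ω ^ 2 = (∑ m ∈ N, smolyakCoeff (N \ T) m * Y (y m) ω)
        * ∑ m ∈ N, smolyakCoeff (N \ T) m * Y (y m) ω := by
      intro ω
      have h1 := sub_sum_smolyakCoeff hTN (Nat.le_add_left 1 τ) fun m => Y (y m) ω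
      have h2 : y (fun _ => τ + 1) = z := funext hbz
      rw [h2] at h1
      rw [linearError, hw fun u => Y u ω, ← h1]
      ring
    simp only [herr]
    rw [hY.integral_sum_mul_sum N N _ _ hyI hyI]
    refine (sum_smolyakCoeff_kernel_le Finset.sdiff_subset hC hk hbI hbn).trans ?_
    gcongr
    -- A level vector of the box outside the sparse set violates the sum constraint, so its total is
    -- at least `τ + e + 1`.
    refine sum_half_pow_level_le _ Finset.sdiff_subset fun l hl => ?_
    obtain ⟨hl1, hl2⟩ := Finset.mem_sdiff.1 hl
    by_contra hlt
    refine hl2 (mem_sparseLevels.2 ⟨fun j => ?_, by omega⟩)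
    exact (Finset.mem_Icc.1 (Fintype.mem_piFinset.1 hl1 j)).1

/-! ### The noise -/

lemma sq_div_le_sq_maxNoise {d n : ℕ} {σ : (Fin d → ℝ) → ℝ} {x : Fin n → Fin d → ℝ}
    {m : Fin n → ℕ} (hσ : ∀ i, 0 ≤ σ (x i)) (i : Fin n) :
    σ (x i) ^ 2 / m i ≤ maxNoise σ x m ^ 2 := by
  have h1 : (m i : ℝ) ^ (-(1 / 2) : ℝ) * σ (x i) ≤ maxNoise σ x m :=
    le_ciSup (f := fun i => (m i : ℝ) ^ (-(1 / 2) : ℝ) * σ (x i)) (Set.finite_range _).bddAbove i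
  have h2 : 0 ≤ (m i : ℝ) ^ (-(1 / 2) : ℝ) * σ (x i) := mul_nonneg (by positivity) (hσ i)
  have h3 : σ (x i) ^ 2 / m i = ((m i : ℝ) ^ (-(1 / 2) : ℝ) * σ (x i)) ^ 2 := by
    have h4 : ((m i : ℝ) ^ (-(1 / 2) : ℝ)) ^ 2 = (m i : ℝ)⁻¹ := by
      rw [← Real.rpow_natCast, ← Real.rpow_mul (Nat.cast_nonneg _)]
      norm_num
      exact Real.rpow_neg_one _
    rw [mul_pow, h4]
    ring
  rw [h3]
  exact pow_le_pow_left₀ h2 h1 2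

lemma maxNoise_nonneg {d n : ℕ} {σ : (Fin d → ℝ) → ℝ} {x : Fin n → Fin d → ℝ}
    {m : Fin n → ℕ} (hσ : ∀ i, 0 ≤ σ (x i)) : 0 ≤ maxNoise σ x m :=
  Real.iSup_nonneg fun i => mul_nonneg (by positivity) (hσ i)

/-- Uses `∑ w_i² ≤ (∑ |w_i|)²`, so control of the total mass suffices. -/
lemma sum_sq_mul_noise_le {d n : ℕ} {σ : (Fin d → ℝ) → ℝ} {x : Fin n → Fin d → ℝ}
    {m : Fin n → ℕ} (hσ : ∀ i, 0 ≤ σ (x i)) (w : Fin n → ℝ) {S : ℝ} (hS : ∑ i, |w i| ≤ S) :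
    ∑ i, w i ^ 2 * (σ (x i) ^ 2 / m i) ≤ S ^ 2 * maxNoise σ x m ^ 2 := by
  have hS0 : 0 ≤ S := (Finset.sum_nonneg fun i _ => abs_nonneg (w i)).trans hS
  have hwi : ∀ i, |w i| ≤ S := fun i =>
    (Finset.single_le_sum (f := fun i => |w i|) (fun _ _ => abs_nonneg _) (Finset.mem_univ i)).trans
      hS
  calc _ ≤ ∑ i, (S * |w i|) * maxNoise σ x m ^ 2 := by
        refine Finset.sum_le_sum fun i _ => ?_
        refine mul_le_mul ?_ (sq_div_le_sq_maxNoise hσ i) (by positivity) (by positivity)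
        rw [← sq_abs, sq]
        exact mul_le_mul_of_nonneg_right (hwi i) (abs_nonneg _)
    _ = S * (∑ i, |w i|) * maxNoise σ x m ^ 2 := by
        rw [← Finset.sum_mul, ← Finset.mul_sum]
    _ ≤ S * S * maxNoise σ x m ^ 2 := by gcongr
    _ = _ := by ring

/-! ### Rates in terms of the size of the design -/

lemma level_le_log {n τ : ℕ} (hn : 2 ≤ n) (h : 2 ^ τ - 1 ≤ n) : (τ : ℝ) ≤ 4 * Real.log n := by
  have h1 : (2 : ℝ) ^ τ ≤ (n : ℝ) ^ 2 := by
    -- For `n ≥ 2`, `2^τ ≤ n + 1 ≤ n²`; the constant `4` then comes from `log 2 > 1/2`.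
    have : 2 ^ τ ≤ n ^ 2 := by nlinarith [Nat.sub_le_iff_le_add.1 h]
    exact_mod_cast this
  have h2 := Real.log_le_log (by positivity) h1
  rw [Real.log_pow, Real.log_pow] at h2
  push_cast at h2
  have h3 := Real.log_two_gt_d9
  nlinarith [Nat.cast_nonneg (α := ℝ) τ]

lemma half_pow_level_le {n τ e : ℕ} (hn : 1 ≤ n) (hτ : 1 ≤ τ)
    (h : n < (sparseGrid (e + 1) (τ + 1)).card) :
    (1 / 2 : ℝ) ^ τ ≤ (n : ℝ)⁻¹ * (((e + 2 : ℝ) * τ) ^ e * 2 ^ (e + 2)) := by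
  have h1 : (n : ℝ) ≤ ((τ + 1 + e : ℕ) : ℝ) ^ e * 2 ^ (τ + 1 + e + 1) :=
    le_trans (by exact_mod_cast h.le) (card_sparseGrid_le e (τ + 1))
  have hτ' : (1 : ℝ) ≤ τ := by exact_mod_cast hτ
  have h2 : ((τ + 1 + e : ℕ) : ℝ) ≤ (e + 2 : ℝ) * τ := by
    push_cast
    nlinarith [Nat.cast_nonneg (α := ℝ) e]
  have hn' : (0 : ℝ) < n := by exact_mod_cast hn
  have h3 : (n : ℝ) ≤ ((e + 2 : ℝ) * τ) ^ e * 2 ^ (e + 2) * 2 ^ τ := by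
    calc (n : ℝ) ≤ ((τ + 1 + e : ℕ) : ℝ) ^ e * 2 ^ (τ + 1 + e + 1) := h1
      _ ≤ ((e + 2 : ℝ) * τ) ^ e * 2 ^ (τ + 1 + e + 1) := by gcongr
      _ = _ := by ring
  rw [div_pow, one_pow, inv_mul_eq_div, div_le_div_iff₀ (by positivity) hn', one_mul]
  exact h3

/-- The bias has order `τ^e 2^{-τ}`. The size of the next grid turns `2^{-τ}` into `τ^e / n`, and `τ
≤ 4 log n` finishes; hence the exponent `2 * e`. -/
lemma exists_bound_rate (e : ℕ) {C : ℝ} (hC : 0 ≤ C) :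
    ∃ K : ℝ, 0 ≤ K ∧ ∀ n τ : ℕ, 2 ≤ n → 1 ≤ τ → (sparseGrid (e + 1) τ).card ≤ n →
      n < (sparseGrid (e + 1) (τ + 1)).card →
      (6 * C) ^ (e + 1) * (8 ^ (e + 1) * (((τ + 1 : ℕ) : ℝ) ^ e * (2 * (1 / 2) ^ (τ + e + 1))))
          ≤ K * ((n : ℝ)⁻¹ * Real.log n ^ (2 * e)) ∧
        (((τ + e : ℕ) : ℝ) ^ (e + 1) * 2 ^ (e + 1)) ^ 2 ≤ K * (Real.log n ^ (e + 1)) ^ 2 := by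
  set K₁ : ℝ := (6 * C) ^ (e + 1) * (8 ^ (e + 1) * (2 ^ e * 2 * ((e + 2) ^ e * 2 ^ (e + 2))
    * 4 ^ (2 * e))) with hK₁
  set K₂ : ℝ := ((e + 1) ^ (e + 1) * 4 ^ (e + 1) * 2 ^ (e + 1)) ^ 2 with hK₂
  have hK₁0 : 0 ≤ K₁ := by positivity
  have hK₂0 : 0 ≤ K₂ := by positivity
  refine ⟨K₁ + K₂, by positivity, fun n τ hn hτ hle hlt => ?_⟩
  have hlog := level_le_log hn ((two_pow_le_card_sparseGrid e hτ).trans hle)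
  have hτ' : (1 : ℝ) ≤ τ := by exact_mod_cast hτ
  have hlog0 : 0 ≤ Real.log n := by linarith
  have hhalf := half_pow_level_le (e := e) (by omega : 1 ≤ n) hτ hlt
  constructor
  · have h1 : ((τ + 1 : ℕ) : ℝ) ≤ 2 * τ := by push_cast; linarith
    have h2 : (1 / 2 : ℝ) ^ (τ + e + 1) ≤ (1 / 2) ^ τ :=
      pow_le_pow_of_le_one (by norm_num) (by norm_num) (by omega)
    calc (6 * C) ^ (e + 1) * (8 ^ (e + 1) * (((τ + 1 : ℕ) : ℝ) ^ e * (2 * (1 / 2) ^ (τ + e + 1))))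
        ≤ (6 * C) ^ (e + 1) * (8 ^ (e + 1) * ((2 * τ : ℝ) ^ e
          * (2 * ((n : ℝ)⁻¹ * (((e + 2 : ℝ) * τ) ^ e * 2 ^ (e + 2)))))) := by
          gcongr
          exact h2.trans hhalf
      _ = (6 * C) ^ (e + 1) * (8 ^ (e + 1) * (2 ^ e * 2 * ((e + 2) ^ e * 2 ^ (e + 2))))
          * ((n : ℝ)⁻¹ * (τ : ℝ) ^ (2 * e)) := by
          rw [mul_pow (2 : ℝ) (τ : ℝ), mul_pow ((e : ℝ) + 2) (τ : ℝ), two_mul e,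
            pow_add (τ : ℝ)]
          ring
      _ ≤ (6 * C) ^ (e + 1) * (8 ^ (e + 1) * (2 ^ e * 2 * ((e + 2) ^ e * 2 ^ (e + 2))))
          * ((n : ℝ)⁻¹ * (4 * Real.log n) ^ (2 * e)) := by gcongr
      _ = K₁ * ((n : ℝ)⁻¹ * Real.log n ^ (2 * e)) := by rw [hK₁, mul_pow (4 : ℝ)]; ring
      _ ≤ _ := by gcongr; linarith
  · have h1 : ((τ + e : ℕ) : ℝ) ≤ (e + 1) * (4 * Real.log n) := by
      have : ((τ + e : ℕ) : ℝ) ≤ (e + 1) * τ := by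
        push_cast
        nlinarith [Nat.cast_nonneg (α := ℝ) e]
      exact this.trans (by gcongr)
    calc (((τ + e : ℕ) : ℝ) ^ (e + 1) * 2 ^ (e + 1)) ^ 2
        ≤ (((e + 1) * (4 * Real.log n)) ^ (e + 1) * 2 ^ (e + 1)) ^ 2 := by gcongr
      _ = K₂ * (Real.log n ^ (e + 1)) ^ 2 := by
          rw [hK₂, mul_pow ((e : ℝ) + 1), mul_pow (4 : ℝ)]; ring
      _ ≤ _ := by gcongr; linarith

lemma IsTruncatedSparseGrid.injective {d n : ℕ} {x : Fin n → Fin d → ℝ}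
    (h : IsTruncatedSparseGrid d n (Finset.univ.image x)) : Function.Injective x := by
  have h1 : Set.InjOn x (Finset.univ : Finset (Fin n)) :=
    Finset.card_image_iff.1 (by simpa using h.card_eq)
  rwa [Finset.coe_univ, Set.injOn_univ] at h1

lemma tmKernel_self_le {d : ℕ} {p q : Fin d → ℝ → ℝ} {C : ℝ}
    (hk : ∀ j, IsLipschitzKernel C (markovKernel (p j) (q j))) {z : Fin d → ℝ}
    (hz : z ∈ unitCube d) : tmKernel p q z z ≤ C ^ d := by
  rw [tmKernel_eq_prod]
  refine (le_abs_self _).trans ?_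
  rw [Finset.abs_prod]
  refine (Finset.prod_le_prod (fun _ _ => abs_nonneg _)
    fun j _ => (hk j).bdd _ (hz j) _ (hz j)).trans_eq ?_
  simp

end SparseKriging

/-! ### The convergence rate -/

open SparseKriging in
theorem theorem3 {Ω : Type*} [MeasurableSpace Ω] (P : Measure Ω) [IsProbabilityMeasure P]
    (d : ℕ) (hd : 1 ≤ d)
    (p q : Fin d → ℝ → ℝ) (hTM : SparseKriging.IsTensorMarkov p q)
    (hSL : SparseKriging.SturmLiouvilleRegular p q)
    (Y : (Fin d → ℝ) → Ω → ℝ)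
    (hY : SparseKriging.IsCenteredGP (SparseKriging.unitCube d)
      (SparseKriging.tmKernel p q) Y P)
    (σ : (Fin d → ℝ) → ℝ) (hσ : ∀ z ∈ SparseKriging.unitCube d, 0 ≤ σ z)
    (x : (n : ℕ) → Fin n → Fin d → ℝ)
    (hx : ∀ n, 1 ≤ n → SparseKriging.IsTruncatedSparseGrid d n (Finset.univ.image (x n)))
    (m : (n : ℕ) → Fin n → ℕ) (hm : ∀ n i, 1 ≤ m n i)
    (ε : (n : ℕ) → Fin n → ℕ → Ω → ℝ)
    (hε : ∀ n, SparseKriging.IsSimulationNoise σ (x n) (m n) Y (ε n) P)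
    (hlim : Tendsto (fun n : ℕ => Real.log n ^ d * SparseKriging.maxNoise σ (x n) (m n))
      atTop (𝓝 0)) :
    (∀ n, ∀ z ∈ SparseKriging.unitCube d,
      Integrable (fun ω => (SparseKriging.skPredictor (SparseKriging.tmKernel p q) σ (x n) (m n)
        Y (ε n) z ω - Y z ω) ^ 2) P) ∧
    (∀ n, BddAbove (Set.range fun z : SparseKriging.unitCube d =>
      ∫ ω, (SparseKriging.skPredictor (SparseKriging.tmKernel p q) σ (x n) (m n)
        Y (ε n) z ω - Y z ω) ^ 2 ∂P)) ∧
    (fun n : ℕ => ⨆ z : SparseKriging.unitCube d,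
      ∫ ω, (SparseKriging.skPredictor (SparseKriging.tmKernel p q) σ (x n) (m n)
        Y (ε n) z ω - Y z ω) ^ 2 ∂P)
      =O[atTop] (fun n : ℕ => (n : ℝ)⁻¹ * Real.log n ^ (2 * (d - 1))
        + Real.log n ^ d * SparseKriging.maxNoise σ (x n) (m n)) := by
  have hcube : ∀ n i, x n i ∈ unitCube d := fun n i =>
    (hx n i.pos).subset_unitCube (Finset.mem_image_of_mem _ (Finset.mem_univ i))
  have hinj : ∀ n, Function.Injective (x n) := by
    intro n
    rcases Nat.eq_zero_or_pos n with rfl | hn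
    · exact fun i => i.elim0
    · exact (hx n hn).injective
  have hK : ∀ n, (kernelMatrix (tmKernel p q) (x n)).PosDef := fun n =>
    hTM.posDef_kernelMatrix (hcube n) (hinj n)
  obtain ⟨C, hC, hk⟩ := hSL.exists_isLipschitzKernel
  refine ⟨fun n z hz => integrable_sq_skPredictor_sub hY (hε n) (hcube n) (hm n) hz,
    fun n => ⟨C ^ d, ?_⟩, ?_⟩
  · rintro _ ⟨z, rfl⟩
    exact (integral_sq_skPredictor_le_kernel hY (hε n) (hcube n) (hm n) (tmKernel_comm p q) (hK n)
      z.2).trans (tmKernel_self_le hk z.2)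
  · obtain ⟨e, rfl⟩ : ∃ e, d = e + 1 := ⟨d - 1, by omega⟩
    obtain ⟨K, hK0, hrate⟩ := exists_bound_rate e hC
    refine IsBigO.of_bound K ?_
    filter_upwards [hlim.eventually_le_const one_pos, eventually_ge_atTop 2] with n hn1 hn
    -- Nothing about the added points is needed except that the design contains the full grid of
    -- level `τ` and that `n` lies between consecutive grid sizes.
    obtain ⟨τ, hτ, hle, hlt, A, -, -, hX⟩ := hx n (by omega)
    obtain ⟨hbias, hmass⟩ := hrate n τ hn hτ hle hlt
    have hσ' : ∀ i, 0 ≤ σ (x n i) := fun i => hσ _ (hcube n i)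
    have hnoise := maxNoise_nonneg (m := m n) hσ'
    have hlog : 0 ≤ Real.log n := Real.log_natCast_nonneg n
    have hgrid : ∀ y ∈ sparseGrid (e + 1) τ, ∃ i, x n i = y := by
      intro y hy
      have : y ∈ Finset.univ.image (x n) := hX ▸ Finset.mem_union_left _ hy
      simpa using this
    rw [Real.norm_of_nonneg (Real.iSup_nonneg fun z => integral_nonneg fun ω => sq_nonneg _),
      Real.norm_of_nonneg (by positivity)]
    refine Real.iSup_le (fun z => ?_) (by positivity)
    obtain ⟨w, hw, hwe⟩ := exists_weights_integral_sq_linearError_le hC hk hY (hinj n) hgrid z.2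
    refine (integral_sq_skPredictor_le hY (hε n) (hcube n) (hm n) (tmKernel_comm p q) (hK n) w
      z.2).trans ?_
    rw [mul_add, Nat.add_sub_cancel]
    refine add_le_add (hwe.trans hbias) ((sum_sq_mul_noise_le hσ' w hw).trans ?_)
    have h0 : 0 ≤ Real.log n ^ (e + 1) * maxNoise σ (x n) (m n) := by positivity
    calc _ ≤ K * (Real.log n ^ (e + 1)) ^ 2 * maxNoise σ (x n) (m n) ^ 2 := by gcongr
      _ = K * ((Real.log n ^ (e + 1) * maxNoise σ (x n) (m n))
          * (Real.log n ^ (e + 1) * maxNoise σ (x n) (m n))) := by ring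
      -- The noise scale is eventually at most `1`, so its square is at most itself.
      _ ≤ K * (Real.log n ^ (e + 1) * maxNoise σ (x n) (m n)) := by
          exact mul_le_mul_of_nonneg_left (mul_le_of_le_one_left h0 hn1) hK0
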